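/- **Setting.** A configuration is a finite set $A\subset\mathbb{Z}^d\smallsetminus\{0\}$ such that the cone $\mathbb{R}_{\ge 0}A$ contains no line. A subset $F\subseteq A$ is a *face* of $A$ if $\mathbb{R}_{\ge 0}F$ is a face of the cone $\mathbb{R}_{\ge 0}A$ and $A\cap\mathbb{R}_{\ge 0}F=F$ (so $F=\varnothing$ is the face $\{0\}$). For $S \subseteq \mathbb{Z}^d$ write $\mathbb{N}S$ and $\mathbb{Z}S$ for the monoid and the group generated by $S$ ($0\in\mathbb{N}$). Let $\Bbbk$ be a field, $\Bbbk[\mathbb{N}A]$ the semigroup ring with monomials $t^a$, $a\in\mathbb{N}A$, and $I=\langle t^b \mid b\in B\rangle\subseteq\Bbbk[\mathbb{N}A]$ a monomial ideal, $B\subseteq \mathbb{N}A$ finite. A *pair* of $A$ is $(a,F)$ with $a\in\mathbb{N}A$ and $F$ a face of $A$. Write $(a,F)\prec(b,G)$ if $a+\mathbb{N}F\subseteq b+\mathbb{N}G$. The pair $(a,F)$ is a *proper pair* of $I$ if $t^{c}\notin I$ for all $c\in a+\mathbb{N}F$; a *standard pair* of $I$ is a proper pair of $I$ that is maximal with respect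 to $\prec$ among the proper pairs of $I$. Pairs $(a,F)$ and $(b,F)$ belonging to the same face *overlap* if $a-b\in\mathbb{Z}F$; this is an equivalence relation, and the equivalence classes of standard pairs of $I$ are the *overlap classes* of standard pairs of $I$. The pair $(a,F)$ *divides* $(b,G)$ if there is $c\in\mathbb{N}A$ with $a+c+\mathbb{N}F\subseteq b+\mathbb{N}G$; an overlap class $C$ divides an overlap class $D$ if some (equivalently, every) pair in $C$ divides some (equivalently, every) pair in $D$. An overlap class $C$ of standard pairs of $I$ is *maximal with respect to divisibility* if the only overlap class of standard pairs of $I$ divided by $C$ is $C$ itself. **Theorem.** There is an algorithm (a partial recursive function) whose input consists of $d$, a list of the elements of a configuration $A\subset\mathbb{Z}^d$, and a list of the elements of a finite set $B\subseteq\mathbb{N}A$ of exponents of monomial generators of a monomial ideal $I=\langle t^b\mid b\in B\rangle$ of $\Bbbk[\mathbb{N}A]$, and which, on every such input, halts and outputs 1. the finite set of standard pairs of $I$ (listed without repetition), 2. the finite set of overlap classes of standard pairs of $I$, each given as the list of its elements, and 3. those overlap classes of standard pairs of $I$ that are maximal with respect to divisibility. The output does not depend on the field $\Bbbk$. -/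

import Mathlib

namespace AffineSemigroup

/-! ### Configurations, faces, semigroup rings -/

/-- The affine semigroup `ℕS`: nonnegative integer combinations of the elements of `S ⊆ ℤ^d`. -/
abbrev NN {d : ℕ} (S : Finset (Fin d → ℤ)) : AddSubmonoid (Fin d → ℤ) :=
  AddSubmonoid.closure (S : Set (Fin d → ℤ))

/-- The group `ℤS`: integer combinations of the elements of `S ⊆ ℤ^d`. -/
abbrev ZZ {d : ℕ} (S : Finset (Fin d → ℤ)) : AddSubgroup (Fin d → ℤ) :=
  AddSubgroup.closure (S : Set (Fin d → ℤ))

/-- A lattice point, regarded as a point of `ℝ^d`. -/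
def toReal {d : ℕ} (v : Fin d → ℤ) : Fin d → ℝ := fun i => (v i : ℝ)

/-- The cone `ℝ_{≥0} S ⊆ ℝ^d` over a finite set `S ⊆ ℤ^d`. -/
noncomputable def cone {d : ℕ} (S : Finset (Fin d → ℤ)) : PointedCone ℝ (Fin d → ℝ) :=
  PointedCone.hull ℝ (toReal '' (S : Set (Fin d → ℤ)))

/-- A configuration: a finite set of nonzero lattice points whose cone is strongly convex,
that is, contains no line through the origin. -/
structure IsConfiguration {d : ℕ} (A : Finset (Fin d → ℤ)) : Prop where
  zero_notMem : (0 : Fin d → ℤ) ∉ A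
  stronglyConvex : ∀ x : Fin d → ℝ, x ∈ cone A → -x ∈ cone A → x = 0

/-- `F ⊆ A` is a face of `A` if the cone over `F` is a face of the cone over `A`, and `F` consists
of all the elements of `A` in the cone over `F`. -/
structure IsFace {d : ℕ} (A F : Finset (Fin d → ℤ)) : Prop where
  subset : F ⊆ A
  isFaceOf : (cone F).IsFaceOf (cone A)
  mem_of_mem_cone : ∀ a ∈ A, toReal a ∈ cone F → a ∈ F

/-- The semigroup ring `k[ℕA]`. -/
abbrev SemigroupRing (k : Type*) [Field k] {d : ℕ} (A : Finset (Fin d → ℤ)) : Type _ :=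
  AddMonoidAlgebra k (NN A)

/-- The monomial `t^a` of `k[ℕA]`. -/
noncomputable def monomial (k : Type*) [Field k] {d : ℕ} {A : Finset (Fin d → ℤ)} (a : NN A) :
    SemigroupRing k A :=
  AddMonoidAlgebra.single a (1 : k)

/-- The monomial ideal of `k[ℕA]` generated by the monomials `t^b` with `b ∈ B`
(to be used with `B ⊆ ℕA`). -/
noncomputable def monomialIdeal (k : Type*) [Field k] {d : ℕ} (A B : Finset (Fin d → ℤ)) :
    Ideal (SemigroupRing k A) :=
  Ideal.span {x | ∃ b : NN A, (b : Fin d → ℤ) ∈ B ∧ x = monomial k b}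

/-- The exponents of the standard monomials of `I`: those `a ∈ ℕA` with `t^a ∉ I`. -/
def stdMono {k : Type*} [Field k] {d : ℕ} {A : Finset (Fin d → ℤ)}
    (I : Ideal (SemigroupRing k A)) : Set (Fin d → ℤ) :=
  {a | ∃ h : a ∈ NN A, monomial k ⟨a, h⟩ ∉ I}

/-! ### Pairs -/

/-- The underlying data `(a, F)` of a pair. -/
abbrev PairData (d : ℕ) : Type := (Fin d → ℤ) × Finset (Fin d → ℤ)

/-- `(a, F)` is a pair of `A`: `a ∈ ℕA`, and `F` is a face of `A`. -/
def IsPair {d : ℕ} (A : Finset (Fin d → ℤ)) (p : PairData d) : Prop :=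
  p.1 ∈ NN A ∧ IsFace A p.2

/-- The set `a + ℕF`. -/
def pairSet {d : ℕ} (a : Fin d → ℤ) (F : Finset (Fin d → ℤ)) : Set (Fin d → ℤ) :=
  {x | ∃ c ∈ NN F, x = a + c}

/-- `(a, F) ≺ (b, G)`: the set `a + ℕF` is contained in `b + ℕG`. -/
def Prec {d : ℕ} (p q : PairData d) : Prop :=
  pairSet p.1 p.2 ⊆ pairSet q.1 q.2

/-- `(a, F)` and `(b, G)` overlap: `F = G` and `a - b ∈ ℤF`. -/
def Overlap {d : ℕ} (p q : PairData d) : Prop :=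
  p.2 = q.2 ∧ p.1 - q.1 ∈ ZZ p.2

/-- `(a, F)` divides `(b, G)`: there is `c ∈ ℕA` with `a + c + ℕF ⊆ b + ℕG`. -/
def Divides {d : ℕ} (A : Finset (Fin d → ℤ)) (p q : PairData d) : Prop :=
  ∃ c ∈ NN A, pairSet (p.1 + c) p.2 ⊆ pairSet q.1 q.2

/-- A proper pair of `I`: a pair `(a, F)` of `A` with `a + ℕF` contained in the set of exponents
of standard monomials of `I`. -/
def IsProperPair {k : Type*} [Field k] {d : ℕ} {A : Finset (Fin d → ℤ)}
    (I : Ideal (SemigroupRing k A)) (p : PairData d) : Prop :=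
  IsPair A p ∧ pairSet p.1 p.2 ⊆ stdMono I

/-- The standard pairs of `I`: the proper pairs of `I` that are maximal with respect to `≺`. -/
def stdPairs {k : Type*} [Field k] {d : ℕ} {A : Finset (Fin d → ℤ)}
    (I : Ideal (SemigroupRing k A)) : Set (PairData d) :=
  {p | IsProperPair I p ∧ ∀ q, IsProperPair I q → Prec p q → q = p}

/-- The overlap classes of standard pairs of `I`. -/
def overlapClasses {k : Type*} [Field k] {d : ℕ} {A : Finset (Fin d → ℤ)}
    (I : Ideal (SemigroupRing k A)) : Set (Set (PairData d)) :=
  {C | ∃ p ∈ stdPairs I, C = {q | q ∈ stdPairs I ∧ Overlap p q}}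

/-- Divisibility of overlap classes, through representatives. -/
def ClassDivides {d : ℕ} (A : Finset (Fin d → ℤ)) (C D : Set (PairData d)) : Prop :=
  ∃ p ∈ C, ∃ q ∈ D, Divides A p q

/-- The overlap classes of standard pairs of `I` that are maximal with respect to divisibility. -/
def maximalOverlapClasses {k : Type*} [Field k] {d : ℕ} {A : Finset (Fin d → ℤ)}
    (I : Ideal (SemigroupRing k A)) : Set (Set (PairData d)) :=
  {C | C ∈ overlapClasses I ∧ ∀ D ∈ overlapClasses I, ClassDivides A C D → D = C}

/-! ### Inputs and outputs of algorithms -/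

/-- A vector is written as the list of its coordinates. -/
abbrev VecCode : Type := List ℤ

/-- A pair `(a, F)` is written as the code of `a` with a list of the codes of the elements
of `F`. -/
abbrev PairCode : Type := VecCode × List VecCode

/-- The code of a lattice point. -/
def vecCode {d : ℕ} (v : Fin d → ℤ) : VecCode := List.ofFn v

/-- The list `L` of codes lists the elements of the (finite) set `S` without repetition, in some
order; here `R c s` says that `c` is a code of `s`. -/
def Lists {α β : Type*} (R : α → β → Prop) (L : List α) (S : Set β) : Prop :=
  ∃ l : List β, l.Nodup ∧ (∀ s, s ∈ l ↔ s ∈ S) ∧ List.Forall₂ R L l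

/-- `c` is a code of the lattice point `v`. -/
def CodesVec {d : ℕ} (c : VecCode) (v : Fin d → ℤ) : Prop := c = vecCode v

/-- `c` is a code of the pair `p`. -/
def CodesPair {d : ℕ} (c : PairCode) (p : PairData d) : Prop :=
  CodesVec c.1 p.1 ∧ Lists CodesVec c.2 (p.2 : Set (Fin d → ℤ))

/-- `L` is a code of the finite set `S` of pairs. -/
def CodesPairSet {d : ℕ} (L : List PairCode) (S : Set (PairData d)) : Prop :=
  Lists CodesPair L S

/-- `L` is a code of the finite set `𝒮` of finite sets of pairs. -/
def CodesPairSets {d : ℕ} (L : List (List PairCode)) (𝒮 : Set (Set (PairData d))) : Prop :=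
  Lists CodesPairSet L 𝒮

/-- An input: the dimension `d`, the elements of `A`, and the exponents of the generators. -/
abbrev Input : Type := ℕ × List VecCode × List VecCode

/-- An output: the standard pairs, their overlap classes, and the overlap classes that are maximal
with respect to divisibility. -/
abbrev Output : Type := List PairCode × List (List PairCode) × List (List PairCode)

end AffineSemigroup

open AffineSemigroup

namespace AffineSemigroup

-- The algorithm is an unbounded search. If the relation "this output is correct for this input" is
-- recursively enumerable, and every valid input has a correct output, then trying all candidates
-- together with all certificates must halt (`Sigma1.exists_partrec`). So it suffices to give every
-- part of the output, positive or negative, a finite certificate.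
--
-- Everything reduces to faces `F` and membership of lattice points in `ℕA - ℕF`. By
-- `mem_stdPairs_iff`, standard pairs are described in these terms alone, and the field disappears.
-- Membership is witnessed by two lists of vectors. For non-membership (`IsFace.avoids_iff`), a
-- functional exposing `F` bounds how often elements of `A ∖ F` can be subtracted, so finitely many
-- points remain to be kept out of `ℤF`; each is kept out by a homomorphism to a finite cyclic group
-- (`separated_iff`). Faces are certified by an integral exposing functional, which exists by an
-- integral Farkas lemma; a subset that is not a face is refuted by some `a ∈ A ∖ F` with `-a ∈ ℕA -
-- ℕF`.
--
-- It remains to certify that a list of standard pairs is complete. For a fixed face `F`, the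
-- translate `0 + ℕA` is split repeatedly, `x + ℕT` into `x + t + ℕT` and `x + ℕ(T ∖ {t})`, until
-- each piece either visibly contains no `F`-standard point or is a single listed point. By
-- Dickson's lemma a finite tree suffices (`exists_isTree`), and every such tree is conclusive
-- (`IsTree.of_isStandard`). The same tree shows that there are finitely many standard pairs, hence
-- that a correct output exists. Overlap and divisibility of the pairs found are again membership
-- questions of the two kinds above.

attribute [fun_prop] Primrec
attribute [fun_prop] Primrec.fst Primrec.snd Primrec.pair Primrec.const Primrec.comp Primrec.id

/-! ### Recursively enumerable predicates in normal form -/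

/-- A predicate of the form `∃ k, q (x, k)` with `q` primitive recursive. -/
def Sigma1 {α : Type*} [Primcodable α] (p : α → Prop) : Prop :=
  ∃ q : α × ℕ → Prop, PrimrecPred q ∧ ∀ x, p x ↔ ∃ k, q (x, k)

section

variable {α β γ : Type*} [Primcodable α] [Primcodable β] [Primcodable γ]

theorem primrecPred_exists_mem {p : α × β → Prop} (hp : PrimrecPred p) {L : α → List β}
    (hL : Primrec L) : PrimrecPred fun x => ∃ y ∈ L x, p (x, y) := by
  have h : PrimrecRel fun (y : β) (x : α) => p (x, y) :=
    PrimrecPred.primrecRel (p := fun z : β × α => p (z.2, z.1)) (hp.comp (by fun_prop))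
  exact h.exists_mem_list.comp hL Primrec.id

theorem primrecPred_forall_mem {p : α × β → Prop} (hp : PrimrecPred p) {L : α → List β}
    (hL : Primrec L) : PrimrecPred fun x => ∀ y ∈ L x, p (x, y) := by
  have h : PrimrecRel fun (y : β) (x : α) => p (x, y) :=
    PrimrecPred.primrecRel (p := fun z : β × α => p (z.2, z.1)) (hp.comp (by fun_prop))
  exact h.forall_mem_list.comp hL Primrec.id

theorem primrecPred_exists_lt {p : α × ℕ → Prop} (hp : PrimrecPred p) {n : α → ℕ}
    (hn : Primrec n) : PrimrecPred fun x => ∃ i < n x, p (x, i) :=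
  (primrecPred_exists_mem hp (Primrec.list_range.comp hn)).of_eq fun x => by simp

theorem primrecPred_forall_lt {p : α × ℕ → Prop} (hp : PrimrecPred p) {n : α → ℕ}
    (hn : Primrec n) : PrimrecPred fun x => ∀ i < n x, p (x, i) :=
  (primrecPred_forall_mem hp (Primrec.list_range.comp hn)).of_eq fun x => by simp

theorem primrec_add {f g : α → ℕ} (hf : Primrec f) (hg : Primrec g) :
    Primrec fun x => f x + g x :=
  Primrec.nat_add.comp hf hg

theorem primrec_sub {f g : α → ℕ} (hf : Primrec f) (hg : Primrec g) :
    Primrec fun x => f x - g x :=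
  Primrec.nat_sub.comp hf hg

theorem primrec_mul {f g : α → ℕ} (hf : Primrec f) (hg : Primrec g) :
    Primrec fun x => f x * g x :=
  Primrec.nat_mul.comp hf hg

attribute [fun_prop] Primrec.unpair primrec_add primrec_sub primrec_mul

namespace Sigma1

theorem of_primrec {p : α → Prop} (hp : PrimrecPred p) : Sigma1 p :=
  ⟨fun z => p z.1, hp.comp Primrec.fst, fun x => by simp⟩

theorem congr {p q : α → Prop} (hq : Sigma1 q) (h : ∀ x, p x ↔ q x) : Sigma1 p := by
  rwa [show p = q from funext fun x => propext (h x)]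

theorem comp {p : β → Prop} (hp : Sigma1 p) {f : α → β} (hf : Primrec f) :
    Sigma1 fun x => p (f x) := by
  obtain ⟨q, hq, h⟩ := hp
  exact ⟨fun z => q (f z.1, z.2), hq.comp (by fun_prop), fun x => h (f x)⟩

theorem and {p q : α → Prop} (hp : Sigma1 p) (hq : Sigma1 q) : Sigma1 fun x => p x ∧ q x := by
  obtain ⟨p', hp', h₁⟩ := hp
  obtain ⟨q', hq', h₂⟩ := hq
  refine ⟨fun z => p' (z.1, z.2.unpair.1) ∧ q' (z.1, z.2.unpair.2),
    (hp'.comp (by fun_prop)).and (hq'.comp (by fun_prop)), fun x => ?_⟩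
  simp only [h₁, h₂]
  constructor
  · rintro ⟨⟨k, hk⟩, ⟨l, hl⟩⟩
    exact ⟨Nat.pair k l, by simpa using ⟨hk, hl⟩⟩
  · rintro ⟨k, hk, hl⟩
    exact ⟨⟨_, hk⟩, ⟨_, hl⟩⟩

theorem or {p q : α → Prop} (hp : Sigma1 p) (hq : Sigma1 q) : Sigma1 fun x => p x ∨ q x := by
  obtain ⟨p', hp', h₁⟩ := hp
  obtain ⟨q', hq', h₂⟩ := hq
  refine ⟨fun z => p' z ∨ q' z, hp'.or hq', fun x => ?_⟩
  simp only [h₁, h₂, exists_or]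

theorem exists_code {p : α → β → Prop} (hp : Sigma1 fun z : α × β => p z.1 z.2) :
    Sigma1 fun x => ∃ y, p x y := by
  obtain ⟨q, hq, h⟩ := hp
  -- One number codes both the witness and the stage at which it is accepted. Read as a list, the
  -- decoded option has at most one element, so this is a bounded quantifier.
  refine ⟨fun z => ∃ y ∈ (Encodable.decode (α := β) z.2.unpair.1).toList,
    q ((z.1, y), z.2.unpair.2),
    primrecPred_exists_mem (p := fun w : (α × ℕ) × β => q ((w.1.1, w.2), w.1.2.unpair.2))
      (hq.comp (by fun_prop))
      (Primrec.optionToList.comp (Primrec.decode.comp (by fun_prop))), fun x => ?_⟩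
  constructor
  · rintro ⟨y, hy⟩
    obtain ⟨k, hk⟩ := (h (x, y)).1 hy
    exact ⟨Nat.pair (Encodable.encode y) k, y, by simp, by simpa using hk⟩
  · rintro ⟨k, y, -, hy⟩
    exact ⟨y, (h (x, y)).2 ⟨_, hy⟩⟩

/-- Existential quantification over a type that is coded surjectively, depending on the context. -/
theorem exists_surj {γ : α → Type*} (δ : ∀ x, β → γ x) (hδ : ∀ x, Function.Surjective (δ x))
    {p : ∀ x, γ x → Prop} (hp : Sigma1 fun z : α × β => p z.1 (δ z.1 z.2)) :
    Sigma1 fun x => ∃ y, p x y :=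
  (exists_code (p := fun x y => p x (δ x y)) hp).congr fun x => (hδ x).exists

theorem exists_mem {L : α → List β} (hL : Primrec L) {p : α → β → Prop}
    (hp : Sigma1 fun z : α × β => p z.1 z.2) : Sigma1 fun x => ∃ y ∈ L x, p x y := by
  obtain ⟨q, hq, h⟩ := hp
  refine ⟨fun z => ∃ y ∈ L z.1, q ((z.1, y), z.2),
    primrecPred_exists_mem (p := fun w : (α × ℕ) × β => q ((w.1.1, w.2), w.1.2))
      (hq.comp (by fun_prop)) (by fun_prop), fun x => ?_⟩
  constructor
  · rintro ⟨y, hy, hp⟩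
    obtain ⟨k, hk⟩ := (h (x, y)).1 hp
    exact ⟨k, y, hy, hk⟩
  · rintro ⟨k, y, hy, hk⟩
    exact ⟨y, hy, (h (x, y)).2 ⟨k, hk⟩⟩

/-- Collection: the finitely many members of the list have witnesses with a common bound, and that
bound is the single unbounded quantifier of the normal form. -/
theorem forall_mem {L : α → List β} (hL : Primrec L) {p : α → β → Prop}
    (hp : Sigma1 fun z : α × β => p z.1 z.2) : Sigma1 fun x => ∀ y ∈ L x, p x y := by
  obtain ⟨q, hq, h⟩ := hp
  refine ⟨fun z => ∀ y ∈ L z.1, ∃ k < z.2, q ((z.1, y), k),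
    primrecPred_forall_mem (p := fun w : (α × ℕ) × β => ∃ k < w.1.2, q ((w.1.1, w.2), k))
      (primrecPred_exists_lt
        (p := fun v : ((α × ℕ) × β) × ℕ => q ((v.1.1.1, v.1.2), v.2))
        (hq.comp (by fun_prop)) (by fun_prop)) (by fun_prop), fun x => ?_⟩
  constructor
  · intro H
    have H' : ∀ y, ∃ k, y ∈ L x → q ((x, y), k) := fun y => by
      by_cases hy : y ∈ L x
      · obtain ⟨k, hk⟩ := (h (x, y)).1 (H y hy)
        exact ⟨k, fun _ => hk⟩
      · exact ⟨0, fun h => absurd h hy⟩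
    choose g hg using H'
    -- The sum dominates each witness; the successor makes the bound strict.
    refine ⟨((L x).map g).sum + 1, fun y hy => ⟨g y, ?_, hg y hy⟩⟩
    exact Nat.lt_succ_of_le (List.le_sum_of_mem (List.mem_map_of_mem hy))
  · rintro ⟨K, hK⟩ y hy
    obtain ⟨k, -, hk⟩ := hK y hy
    exact (h (x, y)).2 ⟨k, hk⟩

theorem exists_mem_map {γ : α → Type*} (δ : ∀ x, β → γ x) {L : α → List β} (hL : Primrec L)
    {p : ∀ x, γ x → Prop} (hp : Sigma1 fun z : α × β => p z.1 (δ z.1 z.2)) :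
    Sigma1 fun x => ∃ y ∈ (L x).map (δ x), p x y :=
  (exists_mem hL (p := fun x y => p x (δ x y)) hp).congr fun x => by simp

theorem forall_mem_map {γ : α → Type*} (δ : ∀ x, β → γ x) {L : α → List β} (hL : Primrec L)
    {p : ∀ x, γ x → Prop} (hp : Sigma1 fun z : α × β => p z.1 (δ z.1 z.2)) :
    Sigma1 fun x => ∀ y ∈ (L x).map (δ x), p x y :=
  (forall_mem hL (p := fun x y => p x (δ x y)) hp).congr fun x => by simp

theorem pairwise [Inhabited β] {L : α → List β} (hL : Primrec L) {p : α → β → β → Prop}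
    (hp : Sigma1 fun z : α × β × β => p z.1 z.2.1 z.2.2) :
    Sigma1 fun x => (L x).Pairwise (p x) := by
  have h : Sigma1 fun x => ∀ j ∈ List.range (L x).length, ∀ i ∈ List.range j,
      p x ((L x).getD i default) ((L x).getD j default) := by
    refine forall_mem (Primrec.list_range.comp (Primrec.list_length.comp hL)) ?_
    refine forall_mem (Primrec.list_range.comp Primrec.snd) ?_
    exact hp.comp (f := fun z : (α × ℕ) × ℕ =>
      (z.1.1, (L z.1.1).getD z.2 default, (L z.1.1).getD z.1.2 default))
      (Primrec.pair (by fun_prop) (Primrec.pair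
        ((Primrec.list_getD default).comp (by fun_prop) (by fun_prop))
        ((Primrec.list_getD default).comp (by fun_prop) (by fun_prop))))
  refine h.congr fun x => ?_
  simp only [List.pairwise_iff_getElem, List.mem_range]
  constructor
  · intro H j hj i hi
    rw [List.getD_eq_getElem _ _ hj, List.getD_eq_getElem _ _ (hi.trans hj)]
    exact H i j (hi.trans hj) hj hi
  · intro H i j hi hj hij
    have := H j hj i hij
    rwa [List.getD_eq_getElem _ _ hj, List.getD_eq_getElem _ _ hi] at this

/-- A recursively enumerable relation is uniformized by a partial recursive function. -/
theorem exists_partrec {R : α → β → Prop} (hR : Sigma1 fun z : α × β => R z.1 z.2) :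
    ∃ f : α →. β, Partrec f ∧ ∀ x, (∃ y, R x y) → ∃ y ∈ f x, R x y := by
  classical
  obtain ⟨q, hq, h⟩ := hR
  -- `k` encodes a candidate and a stage, and the candidate is returned only if it is accepted at
  -- that stage. The first success of `g x` is therefore a correct value, and there is one as soon
  -- as a correct value exists.
  let g : α → ℕ → Option β := fun x k =>
    (Encodable.decode (α := β) k.unpair.1).bind fun y =>
      if q ((x, y), k.unpair.2) then some y else none
  have hg : Primrec₂ g := by
    refine Primrec.option_bind (Primrec.decode.comp (by fun_prop)) ?_
    refine Primrec.ite (hq.comp (f := fun z : (α × ℕ) × β =>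
      ((z.1.1, z.2), z.1.2.unpair.2)) (by fun_prop)) ?_ (by fun_prop)
    exact Primrec.option_some.comp (by fun_prop)
  refine ⟨fun x => Nat.rfindOpt (g x), Partrec.rfindOpt hg.to_comp, fun x hx => ?_⟩
  obtain ⟨y, hy⟩ := hx
  obtain ⟨k, hk⟩ := (h (x, y)).1 hy
  have hdom : (Nat.rfindOpt (g x)).Dom := by
    rw [Nat.rfindOpt_dom]
    exact ⟨Nat.pair (Encodable.encode y) k, y, by simp [g, hk]⟩
  obtain ⟨z, hz⟩ := Part.dom_iff_mem.1 hdom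
  refine ⟨z, hz, ?_⟩
  obtain ⟨n, hn⟩ := Nat.rfindOpt_spec hz
  simp only [g, Option.mem_def, Option.bind_eq_some_iff] at hn
  obtain ⟨w, -, hw⟩ := hn
  split_ifs at hw with hqw
  obtain rfl : w = z := by simpa using hw
  exact (h (x, w)).2 ⟨_, hqw⟩

end Sigma1

end

/-! ### Primitive recursive integer arithmetic -/

/-- The coding of `ℤ` sends `n ≥ 0` to `2n` and `-(n + 1)` to `2n + 1`, so parity gives the sign and
halving the magnitude. -/
theorem primrec_int_toNat : Primrec Int.toNat := by
  have h : Primrec fun n : ℕ => if n % 2 = 0 then n / 2 else 0 :=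
    Primrec.ite (Primrec.eq.comp (Primrec.nat_mod.comp Primrec.id (Primrec.const 2))
      (Primrec.const 0)) (Primrec.nat_div.comp Primrec.id (Primrec.const 2)) (Primrec.const 0)
  refine (h.comp Primrec.encode).of_eq fun z => ?_
  rcases z with n | n
  · have : Encodable.encode (Int.ofNat n) = 2 * n := rfl
    rw [this]; simp
  · have : Encodable.encode (Int.negSucc n) = 2 * n + 1 := rfl
    rw [this]; simp

theorem primrec_int_negToNat : Primrec fun z : ℤ => (-z).toNat := by
  have h : Primrec fun n : ℕ => if n % 2 = 0 then 0 else n / 2 + 1 :=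
    Primrec.ite (Primrec.eq.comp (Primrec.nat_mod.comp Primrec.id (Primrec.const 2))
      (Primrec.const 0)) (Primrec.const 0)
      (Primrec.succ.comp (Primrec.nat_div.comp Primrec.id (Primrec.const 2)))
  refine (h.comp Primrec.encode).of_eq fun z => ?_
  rcases z with n | n
  · have : Encodable.encode (Int.ofNat n) = 2 * n := rfl
    rw [this]; simp
  · have : Encodable.encode (Int.negSucc n) = 2 * n + 1 := rfl
    rw [this]; simp; omega

theorem primrec_int_subNatNat : Primrec₂ fun m n : ℕ => (m : ℤ) - n := by
  rw [← Primrec₂.encode_iff]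
  have h : Primrec₂ fun m n : ℕ => if n ≤ m then 2 * (m - n) else 2 * (n - m - 1) + 1 := by
    refine Primrec.ite (Primrec.nat_le.comp Primrec.snd Primrec.fst) ?_ ?_ <;> fun_prop
  refine h.of_eq fun m n => ?_
  split_ifs with hmn
  · obtain ⟨k, rfl⟩ := Nat.exists_eq_add_of_le hmn
    have : ((n + k : ℕ) : ℤ) - n = Int.ofNat k := by simp
    rw [this]
    have : Encodable.encode (Int.ofNat k) = 2 * k := rfl
    rw [this]; simp
  · obtain ⟨k, rfl⟩ := Nat.exists_eq_add_of_lt (not_le.1 hmn)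
    have : (m : ℤ) - ((m + k + 1 : ℕ) : ℤ) = Int.negSucc k := by
      rw [Int.negSucc_eq]; push_cast; ring
    rw [this]
    have : Encodable.encode (Int.negSucc k) = 2 * k + 1 := rfl
    rw [this]; simp; omega

section

variable {α : Type*} [Primcodable α] {f g : α → ℤ}

/-- An integer is the difference of its positive and negative parts. Arithmetic on differences of
naturals thus reduces to primitive recursive arithmetic on `ℕ`, with no case distinction on signs.
-/
theorem primrec_int_op {op : ℤ → ℤ → ℤ} {p n : ℕ → ℕ → ℕ → ℕ → ℕ}
    (hp : Primrec fun z : ℕ × ℕ × ℕ × ℕ => p z.1 z.2.1 z.2.2.1 z.2.2.2)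
    (hn : Primrec fun z : ℕ × ℕ × ℕ × ℕ => n z.1 z.2.1 z.2.2.1 z.2.2.2)
    (h : ∀ a b c d : ℕ, op (a - b) (c - d) = (p a b c d : ℤ) - n a b c d)
    (hf : Primrec f) (hg : Primrec g) : Primrec fun x => op (f x) (g x) := by
  have ht : Primrec fun x => ((f x).toNat, (-f x).toNat, (g x).toNat, (-g x).toNat) :=
    Primrec.pair (primrec_int_toNat.comp hf) (Primrec.pair (primrec_int_negToNat.comp hf)
      (Primrec.pair (primrec_int_toNat.comp hg) (primrec_int_negToNat.comp hg)))
  refine (primrec_int_subNatNat.comp (hp.comp ht) (hn.comp ht)).of_eq fun x => ?_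
  rw [← h, Int.toNat_sub_toNat_neg, Int.toNat_sub_toNat_neg]

theorem primrec_int_add (hf : Primrec f) (hg : Primrec g) : Primrec fun x => f x + g x := by
  refine primrec_int_op (op := (· + ·)) (p := fun a _ c _ => a + c) (n := fun _ b _ d => b + d)
    (by fun_prop) (by fun_prop) (fun a b c d => ?_) hf hg
  push_cast; ring

theorem primrec_int_sub (hf : Primrec f) (hg : Primrec g) : Primrec fun x => f x - g x := by
  refine primrec_int_op (op := (· - ·)) (p := fun a _ _ d => a + d) (n := fun _ b c _ => b + c)
    (by fun_prop) (by fun_prop) (fun a b c d => ?_) hf hg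
  push_cast; ring

theorem primrec_int_mul (hf : Primrec f) (hg : Primrec g) : Primrec fun x => f x * g x := by
  refine primrec_int_op (op := (· * ·)) (p := fun a b c d => a * c + b * d)
    (n := fun a b c d => a * d + b * c)
    (by fun_prop) (by fun_prop) (fun a b c d => ?_) hf hg
  push_cast; ring

theorem primrecPred_int_le (hf : Primrec f) (hg : Primrec g) :
    PrimrecPred fun x => f x ≤ g x := by
  refine PrimrecPred.of_eq (Primrec.eq.comp
    (primrec_int_toNat.comp (primrec_int_sub hf hg)) (Primrec.const 0)) fun x => ?_
  simp

theorem primrecPred_int_lt (hf : Primrec f) (hg : Primrec g) :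
    PrimrecPred fun x => f x < g x :=
  (primrecPred_int_le hg hf).not.of_eq fun x => by simp

attribute [fun_prop] primrec_int_add primrec_int_sub primrec_int_mul

theorem primrec_int_sum {β : Type*} [Primcodable β] {L : α → List β} (hL : Primrec L)
    {h : α → β → ℤ} (hh : Primrec fun z : α × β => h z.1 z.2) :
    Primrec fun x => ((L x).map (h x)).sum := by
  have h2 : Primrec fun w : α × β × ℤ => h w.1 w.2.1 + w.2.2 :=
    primrec_int_add (hh.comp (f := fun z : α × β => h z.1 z.2)
      (g := fun w : α × β × ℤ => (w.1, w.2.1)) (by fun_prop)) (by fun_prop)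
  have h1 : Primrec fun x => (L x).foldr (fun b s => h x b + s) 0 :=
    Primrec.list_foldr (h := fun (x : α) (p : β × ℤ) => h x p.1 + p.2) hL (Primrec.const 0) h2
  refine h1.of_eq fun x => ?_
  generalize L x = l
  induction l with
  | nil => rfl
  | cons b l ih => simp [ih]

end

/-! ### Integer linear alternatives and faces -/

section

variable {d : ℕ}

theorem zsmul_mem_of_nonneg {M : AddSubmonoid (Fin d → ℤ)} {x : Fin d → ℤ} (hx : x ∈ M) {k : ℤ}
    (hk : 0 ≤ k) : k • x ∈ M := by
  lift k to ℕ using hk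
  rw [natCast_zsmul]
  exact M.nsmul_mem hx k

/-- Farkas' lemma over the integers. -/
theorem exists_nsmul_mem_or_exists_dotProduct_neg (n : ℕ) :
    ∀ (l : List (Fin d → ℤ)) (y : Fin d → ℤ), l.length = n →
      (∃ N : ℕ, 0 < N ∧ N • y ∈ AddSubmonoid.closure {x | x ∈ l}) ∨
        ∃ w : Fin d → ℤ, (∀ v ∈ l, 0 ≤ w ⬝ᵥ v) ∧ w ⬝ᵥ y < 0 := by
  induction n with
  | zero =>
    intro l y hl
    obtain rfl := List.length_eq_zero_iff.1 hl
    by_cases hy : y = 0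
    · exact Or.inl ⟨1, one_pos, by simp [hy]⟩
    · refine Or.inr ⟨-y, by simp, ?_⟩
      rw [neg_dotProduct, neg_lt_zero]
      have h0 : y ⬝ᵥ y ≠ 0 := fun h => hy (dotProduct_self_eq_zero.1 h)
      have h1 : 0 ≤ y ⬝ᵥ y := Finset.sum_nonneg fun i _ => mul_self_nonneg _
      omega
  | succ n ih =>
    intro l y hl
    obtain ⟨v, l, rfl⟩ := List.exists_cons_of_length_eq_add_one hl
    have hl' : l.length = n := by simpa using hl
    have hmono : AddSubmonoid.closure {x | x ∈ l} ≤ AddSubmonoid.closure {x | x ∈ v :: l} :=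
      AddSubmonoid.closure_mono fun x hx => List.mem_cons_of_mem _ hx
    have hv : v ∈ AddSubmonoid.closure {x | x ∈ v :: l} :=
      AddSubmonoid.subset_closure List.mem_cons_self
    rcases ih l y hl' with ⟨N, hN, hy⟩ | ⟨φ, hφ, hφy⟩
    · exact Or.inl ⟨N, hN, hmono hy⟩
    by_cases hφv : 0 ≤ φ ⬝ᵥ v
    · exact Or.inr ⟨φ, by simpa [hφv] using hφ, hφy⟩
    push Not at hφv
    -- Here `φ` is negative on `v` and on `y`. `T` is the projection along `v` to the hyperplane `φ
    -- = 0`, scaled by `-(φ ⬝ᵥ v) > 0` to stay integral; it kills `v` and leaves one generator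
    -- fewer.
    let T : (Fin d → ℤ) → Fin d → ℤ := fun x => (-(φ ⬝ᵥ v)) • x + (φ ⬝ᵥ x) • v
    rcases ih (l.map T) (T y) (by simpa using hl') with ⟨N, hN, hy⟩ | ⟨ψ, hψ, hψy⟩
    · left
      refine ⟨N * (-(φ ⬝ᵥ v)).toNat, Nat.mul_pos hN (by omega), ?_⟩
      have hT : AddSubmonoid.closure {x | x ∈ l.map T} ≤
          AddSubmonoid.closure {x | x ∈ v :: l} := by
        refine (AddSubmonoid.closure_le).2 fun x hx => ?_
        obtain ⟨u, hu, rfl⟩ := List.mem_map.1 hx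
        exact add_mem (zsmul_mem_of_nonneg
          (AddSubmonoid.subset_closure (List.mem_cons_of_mem _ hu)) (by omega))
          (zsmul_mem_of_nonneg hv (hφ u hu))
      -- Adding `N * (-(φ ⬝ᵥ y))` copies of `v` cancels the `v`-part of `N • T y` and leaves a
      -- positive multiple of `y`.
      have h1 := add_mem (hT hy) (zsmul_mem_of_nonneg hv (k := N * (-(φ ⬝ᵥ y)))
        (mul_nonneg (by positivity) (by omega)))
      convert h1 using 1
      rw [← natCast_zsmul, ← natCast_zsmul]
      push_cast
      rw [Int.toNat_of_nonneg (by omega)]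
      simp only [T]
      module
    -- This is `ψ` pulled back along `T`; it vanishes on `v`.
    · refine Or.inr ⟨(-(φ ⬝ᵥ v)) • ψ + (ψ ⬝ᵥ v) • φ, ?_, ?_⟩
      · intro x hx
        rcases List.mem_cons.1 hx with rfl | hx
        · simp only [add_dotProduct, smul_dotProduct, smul_eq_mul]
          apply le_of_eq; ring
        · have := hψ _ (List.mem_map_of_mem hx)
          simp only [T, dotProduct_add, dotProduct_smul, smul_eq_mul] at this
          simp only [add_dotProduct, smul_dotProduct, smul_eq_mul]
          linarith
      · simp only [T, dotProduct_add, dotProduct_smul, smul_eq_mul] at hψy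
        simp only [add_dotProduct, smul_dotProduct, smul_eq_mul]
        linarith

/-- `x ∈ ℕA - ℕF`. -/
def InLocalization (A F : Finset (Fin d → ℤ)) (x : Fin d → ℤ) : Prop :=
  ∃ u ∈ NN A, ∃ v ∈ NN F, x + v = u

/-- The integral vector `w` exposes `F` as a face of `A`. -/
def Exposes (A F : Finset (Fin d → ℤ)) (w : Fin d → ℤ) : Prop :=
  (∀ f ∈ F, w ⬝ᵥ f = 0) ∧ ∀ a ∈ A, a ∈ F ∨ 0 < w ⬝ᵥ a

theorem NN_mono {A F : Finset (Fin d → ℤ)} (h : F ⊆ A) : NN F ≤ NN A :=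
  AddSubmonoid.closure_mono (by exact_mod_cast h)

theorem mem_NN {A : Finset (Fin d → ℤ)} {a : Fin d → ℤ} (h : a ∈ A) : a ∈ NN A :=
  AddSubmonoid.subset_closure (by exact_mod_cast h)

/-- Farkas for the generators `A ∪ -F` and the target `-a`. The first alternative would put a
multiple of `-a` into `ℕA - ℕF`, so that `a` divides an element of `ℕF`. -/
theorem exists_dotProduct_pos {A F : Finset (Fin d → ℤ)}
    (h : ∀ a ∈ A, a ∉ F → ∀ u ∈ NN A, a + u ∉ NN F) :
    ∀ a ∈ A, a ∉ F → ∃ w : Fin d → ℤ, (∀ f ∈ F, w ⬝ᵥ f ≤ 0) ∧ (∀ b ∈ A, 0 ≤ w ⬝ᵥ b) ∧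
      0 < w ⬝ᵥ a := by
  intro a ha haF
  rcases exists_nsmul_mem_or_exists_dotProduct_neg _ (A.toList ++ F.toList.map (- ·)) (-a) rfl
    with ⟨N, hN, hy⟩ | ⟨w, hw, hwa⟩
  · exfalso
    have key : ∀ x ∈ AddSubmonoid.closure {x | x ∈ A.toList ++ F.toList.map (- ·)},
        InLocalization A F x := by
      intro x hx
      induction hx using AddSubmonoid.closure_induction with
      | mem x hx =>
        rcases List.mem_append.1 hx with hx | hx
        · exact ⟨x, mem_NN (by simpa using hx), 0, zero_mem _, add_zero x⟩
        · obtain ⟨f, hf, rfl⟩ := List.mem_map.1 hx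
          exact ⟨0, zero_mem _, f, mem_NN (by simpa using hf), by simp⟩
      | zero => exact ⟨0, zero_mem _, 0, zero_mem _, by simp⟩
      | add x y _ _ hx hy =>
        obtain ⟨u, hu, v, hv, h₁⟩ := hx
        obtain ⟨u', hu', v', hv', h₂⟩ := hy
        exact ⟨u + u', add_mem hu hu', v + v', add_mem hv hv', by rw [← h₁, ← h₂]; abel⟩
    obtain ⟨u, hu, v, hv, huv⟩ := key _ hy
    -- With `N = M + 1`, one copy of `a` is split off: `a + (M • a + u) = v`.
    obtain ⟨M, rfl⟩ := Nat.exists_eq_succ_of_ne_zero hN.ne'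
    refine h a ha haF (M • a + u) (add_mem (nsmul_mem (mem_NN ha) M) hu) ?_
    convert hv using 1
    rw [← huv, Nat.succ_eq_add_one, add_smul]
    module
  · refine ⟨w, fun f hf => ?_, fun b hb => hw b (by simp [hb]), by simpa using hwa⟩
    have := hw (-f) (by simp [hf])
    simpa using this

/-- Sum the functionals obtained for the individual elements of `A ∖ F`. On `F` each is both `≤ 0`
and `≥ 0`, and on `A ∖ F` at least one summand is positive. -/
theorem exists_exposes {A F : Finset (Fin d → ℤ)} (hFA : F ⊆ A)
    (h : ∀ a ∈ A, a ∉ F → ∀ u ∈ NN A, a + u ∉ NN F) : ∃ w, Exposes A F w := by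
  classical
  have h' : ∀ a, ∃ w : Fin d → ℤ, (∀ f ∈ F, w ⬝ᵥ f ≤ 0) ∧ (∀ b ∈ A, 0 ≤ w ⬝ᵥ b) ∧
      (a ∈ A → a ∉ F → 0 < w ⬝ᵥ a) := fun a => by
    by_cases ha : a ∈ A ∧ a ∉ F
    · obtain ⟨w, h₁, h₂, h₃⟩ := exists_dotProduct_pos h a ha.1 ha.2
      exact ⟨w, h₁, h₂, fun _ _ => h₃⟩
    · exact ⟨0, by simp, by simp, fun h₁ h₂ => absurd ⟨h₁, h₂⟩ ha⟩
  choose w h₁ h₂ h₃ using h'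
  refine ⟨∑ a ∈ A, w a, fun f hf => ?_, fun a ha => ?_⟩
  · rw [sum_dotProduct]
    exact Finset.sum_eq_zero fun a _ => le_antisymm (h₁ a f hf) (h₂ a f (hFA hf))
  · by_cases haF : a ∈ F
    · exact Or.inl haF
    · right
      rw [sum_dotProduct]
      exact Finset.sum_pos' (fun b _ => h₂ b a ha) ⟨a, ha, h₃ a ha haF⟩

theorem toReal_mem_cone {S : Finset (Fin d → ℤ)} {x : Fin d → ℤ} (hx : x ∈ NN S) :
    toReal x ∈ cone S := by
  induction hx using AddSubmonoid.closure_induction with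
  | mem x hx => exact Submodule.subset_span ⟨x, hx, rfl⟩
  | zero =>
    have : toReal (0 : Fin d → ℤ) = 0 := by ext; simp [toReal]
    rw [this]; exact zero_mem _
  | add x y _ _ hx hy =>
    have : toReal (x + y) = toReal x + toReal y := by ext; simp [toReal]
    rw [this]; exact add_mem hx hy

theorem toReal_dotProduct (w v : Fin d → ℤ) :
    toReal w ⬝ᵥ toReal v = ((w ⬝ᵥ v : ℤ) : ℝ) := by
  simp [dotProduct, toReal]

theorem cone_mono {A F : Finset (Fin d → ℤ)} (h : F ⊆ A) : cone F ≤ cone A :=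
  Submodule.span_mono (Set.image_mono (by exact_mod_cast h))

/-- The two claims go through the induction together: a sum of nonnegative values vanishes only if
both summands do. -/
theorem Exposes.dotProduct_nonneg {A F : Finset (Fin d → ℤ)} {w : Fin d → ℤ}
    (h : Exposes A F w) {x : Fin d → ℝ} (hx : x ∈ cone A) :
    0 ≤ toReal w ⬝ᵥ x ∧ (toReal w ⬝ᵥ x = 0 → x ∈ cone F) := by
  induction hx using Submodule.span_induction with
  | mem x hx =>
    obtain ⟨a, ha, rfl⟩ := hx
    rw [toReal_dotProduct]
    rcases h.2 a (by exact_mod_cast ha) with haF | hpos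
    · exact ⟨by simp [h.1 a haF], fun _ => toReal_mem_cone (mem_NN haF)⟩
    · exact ⟨by exact_mod_cast hpos.le, fun h0 => absurd h0 (by exact_mod_cast hpos.ne')⟩
  | zero => exact ⟨by simp, fun _ => zero_mem _⟩
  | add x y _ _ hx hy =>
    rw [dotProduct_add]
    exact ⟨add_nonneg hx.1 hy.1, fun h0 => add_mem
      (hx.2 (by linarith [hx.1, hy.1])) (hy.2 (by linarith [hx.1, hy.1]))⟩
  | smul c x _ hx =>
    have hc : c • x = (c : ℝ) • x := rfl
    rw [hc, dotProduct_smul, smul_eq_mul]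
    refine ⟨mul_nonneg c.2 hx.1, fun h0 => ?_⟩
    rcases mul_eq_zero.1 h0 with h0 | h0
    · rw [h0, zero_smul]; exact zero_mem _
    · exact Submodule.smul_mem _ c (hx.2 h0)

theorem Exposes.dotProduct_eq_zero {A F : Finset (Fin d → ℤ)} {w : Fin d → ℤ}
    (h : Exposes A F w) {x : Fin d → ℝ} (hx : x ∈ cone F) : toReal w ⬝ᵥ x = 0 := by
  induction hx using Submodule.span_induction with
  | mem x hx =>
    obtain ⟨a, ha, rfl⟩ := hx
    rw [toReal_dotProduct, h.1 a (by exact_mod_cast ha), Int.cast_zero]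
  | zero => simp
  | add x y _ _ hx hy => rw [dotProduct_add, hx, hy, add_zero]
  | smul c x _ hx =>
    have hc : c • x = (c : ℝ) • x := rfl
    rw [hc, dotProduct_smul, hx, smul_zero]

theorem Exposes.isFace {A F : Finset (Fin d → ℤ)} {w : Fin d → ℤ} (h : Exposes A F w)
    (hFA : F ⊆ A) : IsFace A F where
  subset := hFA
  isFaceOf :=
    { le := cone_mono hFA
      mem_of_smul_add_mem := fun {x y a} hx hy ha hxy => by
        have h0 := h.dotProduct_eq_zero hxy
        rw [dotProduct_add, dotProduct_smul, smul_eq_mul] at h0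
        have hx' := h.dotProduct_nonneg hx
        have hy' := h.dotProduct_nonneg hy
        refine hx'.2 ?_
        have : a * (toReal w ⬝ᵥ x) = 0 := by
          linarith [mul_nonneg ha.le hx'.1, hy'.1]
        exact (mul_eq_zero.1 this).resolve_left ha.ne' }
  mem_of_mem_cone := fun a ha haF => by
    have h0 := h.dotProduct_eq_zero haF
    rw [toReal_dotProduct] at h0
    rcases h.2 a ha with h1 | h1
    · exact h1
    · exact absurd h0 (by exact_mod_cast h1.ne')

theorem IsFace.mem_of_add_mem {A F : Finset (Fin d → ℤ)} (h : IsFace A F) {a u : Fin d → ℤ}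
    (ha : a ∈ A) (hu : u ∈ NN A) (hau : a + u ∈ NN F) : a ∈ F := by
  refine h.mem_of_mem_cone a ha (h.isFaceOf.mem_of_smul_add_mem (a := 1)
    (toReal_mem_cone (mem_NN ha)) (toReal_mem_cone hu) one_pos ?_)
  have : (1 : ℝ) • toReal a + toReal u = toReal (a + u) := by ext; simp [toReal]
  rw [this]
  exact toReal_mem_cone hau

/-- Converse of `IsFace.mem_of_add_mem`. Together they replace the real cones by a condition on
semigroups: a face is a subset `F` of `A` such that every element of `A` dividing an element of `ℕF`
lies in `F`. -/
theorem isFace_of_forall {A F : Finset (Fin d → ℤ)} (hFA : F ⊆ A)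
    (h : ∀ a ∈ A, a ∉ F → ∀ u ∈ NN A, a + u ∉ NN F) : IsFace A F := by
  obtain ⟨w, hw⟩ := exists_exposes hFA h
  exact hw.isFace hFA

theorem IsFace.exists_exposes {A F : Finset (Fin d → ℤ)} (h : IsFace A F) :
    ∃ w, Exposes A F w :=
  AffineSemigroup.exists_exposes h.subset fun _ ha haF _ hu hau =>
    haF (h.mem_of_add_mem ha hu hau)

theorem IsConfiguration.eq_zero_of_add_eq_zero {A : Finset (Fin d → ℤ)} (hA : IsConfiguration A)
    {x y : Fin d → ℤ} (hx : x ∈ NN A) (hy : y ∈ NN A) (h : x + y = 0) : x = 0 := by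
  have h1 : toReal y = -toReal x := by
    rw [eq_neg_of_add_eq_zero_right h]; ext; simp [toReal]
  have h2 := hA.stronglyConvex _ (toReal_mem_cone hx) (h1 ▸ toReal_mem_cone hy)
  ext i
  have := congrFun h2 i
  simpa [toReal] using this

theorem IsConfiguration.isFace_empty {A : Finset (Fin d → ℤ)} (hA : IsConfiguration A) :
    IsFace A ∅ := by
  refine isFace_of_forall (Finset.empty_subset _) fun a ha _ u hu hau => ?_
  have hau' : a + u = 0 := by simpa [NN] using hau
  exact hA.zero_notMem (hA.eq_zero_of_add_eq_zero (mem_NN ha) hu hau' ▸ ha)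

/-! ### Localizations -/

theorem InLocalization.add {A F : Finset (Fin d → ℤ)} {x y : Fin d → ℤ}
    (hx : InLocalization A F x) (hy : y ∈ NN A) : InLocalization A F (x + y) := by
  obtain ⟨u, hu, v, hv, h⟩ := hx
  exact ⟨u + y, add_mem hu hy, v, hv, by rw [← h]; abel⟩

theorem InLocalization.sub {A F : Finset (Fin d → ℤ)} {x y : Fin d → ℤ}
    (hx : InLocalization A F x) (hy : y ∈ NN F) : InLocalization A F (x - y) := by
  obtain ⟨u, hu, v, hv, h⟩ := hx
  exact ⟨u, hu, v + y, add_mem hv hy, by rw [← h]; abel⟩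

theorem inLocalization_empty {A : Finset (Fin d → ℤ)} {x : Fin d → ℤ} :
    InLocalization A ∅ x ↔ x ∈ NN A := by
  constructor
  · rintro ⟨u, hu, v, hv, h⟩
    have : v = 0 := by simpa [NN] using hv
    rw [this, add_zero] at h
    exact h ▸ hu
  · exact fun h => ⟨x, h, 0, zero_mem _, add_zero x⟩

theorem mem_ZZ_iff {F : Finset (Fin d → ℤ)} {x : Fin d → ℤ} :
    x ∈ ZZ F ↔ ∃ u ∈ NN F, ∃ v ∈ NN F, x + v = u := by
  constructor
  · intro hx
    induction hx using AddSubgroup.closure_induction with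
    | mem x hx => exact ⟨x, AddSubmonoid.subset_closure hx, 0, zero_mem _, add_zero x⟩
    | zero => exact ⟨0, zero_mem _, 0, zero_mem _, add_zero 0⟩
    | add x y _ _ hx hy =>
      obtain ⟨u, hu, v, hv, h₁⟩ := hx
      obtain ⟨u', hu', v', hv', h₂⟩ := hy
      exact ⟨u + u', add_mem hu hu', v + v', add_mem hv hv', by rw [← h₁, ← h₂]; abel⟩
    | neg x _ hx =>
      obtain ⟨u, hu, v, hv, h⟩ := hx
      exact ⟨v, hv, u, hu, by rw [← h]; abel⟩
  · rintro ⟨u, hu, v, hv, h⟩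
    have hle : NN F ≤ (ZZ F).toAddSubmonoid := by
      rw [AddSubmonoid.closure_le]
      exact AddSubgroup.subset_closure
    rw [eq_sub_of_add_eq h]
    exact sub_mem (hle hu) (hle hv)

theorem mem_NN_iff {A : Finset (Fin d → ℤ)} {x : Fin d → ℤ} :
    x ∈ NN A ↔ ∃ l : List (Fin d → ℤ), (∀ v ∈ l, v ∈ A) ∧ l.sum = x := by
  constructor
  · intro h
    obtain ⟨l, hl, rfl⟩ := AddSubmonoid.exists_list_of_mem_closure h
    exact ⟨l, by simpa using hl, rfl⟩
  · rintro ⟨l, hl, rfl⟩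
    exact list_sum_mem fun v hv => mem_NN (hl v hv)

end

section

variable {d : ℕ}

/-! ### Certificates of non-membership -/

/-- A homomorphism to a finite cyclic group that kills `F`, but not `y`. -/
def Separated (F : Finset (Fin d → ℤ)) (y : Fin d → ℤ) : Prop :=
  ∃ (w : Fin d → ℤ) (m r k : ℤ), (∀ f ∈ F, ∃ j : ℤ, w ⬝ᵥ f = m * j) ∧
    w ⬝ᵥ y = m * k + r ∧ 0 < r ∧ r < m

theorem Separated.notMem {F : Finset (Fin d → ℤ)} {y : Fin d → ℤ} (h : Separated F y) :
    y ∉ ZZ F := by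
  obtain ⟨w, m, r, k, hF, hy, hr, hm⟩ := h
  have key : ∀ x ∈ ZZ F, m ∣ w ⬝ᵥ x := by
    intro x hx
    induction hx using AddSubgroup.closure_induction with
    | mem x hx => exact hF x (by exact_mod_cast hx)
    | zero => simp
    | add x y _ _ hx hy => rw [dotProduct_add]; exact dvd_add hx hy
    | neg x _ hx => rw [dotProduct_neg]; exact (dvd_neg).2 hx
  intro hyF
  have h1 := key y hyF
  rw [hy, Int.dvd_add_right (dvd_mul_right m k)] at h1
  exact absurd (Int.le_of_dvd hr h1) (by omega)

/-- Characters with values in `ℚ/ℤ` separate the points of the abelian group `ℤ^d / ℤF`. On `ℤ^d`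
such a character is given by lifting its values on the unit vectors to rational numbers. -/
theorem exists_rat_character {F : Finset (Fin d → ℤ)} {y : Fin d → ℤ} (h : y ∉ ZZ F) :
    ∃ q : Fin d → ℚ, (∀ f ∈ F, ∃ j : ℤ, ∑ i, q i * f i = j) ∧
      ∀ j : ℤ, ∑ i, q i * y i ≠ j := by
  have hy : (QuotientAddGroup.mk y : (Fin d → ℤ) ⧸ ZZ F) ≠ 0 := by
    rwa [Ne, QuotientAddGroup.eq_zero_iff]
  obtain ⟨c, hc⟩ := CharacterModule.exists_character_apply_ne_zero_of_ne_zero hy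
  let χ : (Fin d → ℤ) →+ AddCircle (1 : ℚ) :=
    AddMonoidHom.comp (c : ((Fin d → ℤ) ⧸ ZZ F) →+ AddCircle (1 : ℚ)) (QuotientAddGroup.mk' (ZZ F))
  have hq : ∀ i, ∃ q : ℚ, (q : AddCircle (1 : ℚ)) = χ (Pi.single i 1) := fun i =>
    QuotientAddGroup.mk_surjective _
  choose q hq using hq
  have hχ : ∀ x : Fin d → ℤ, χ x = ((∑ i, q i * x i : ℚ) : AddCircle (1 : ℚ)) := by
    intro x
    have hx : x = ∑ i, x i • (Pi.single i 1 : Fin d → ℤ) := by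
      ext j
      simp [Finset.sum_apply, Pi.single_apply]
    conv_lhs => rw [hx]
    rw [map_sum]
    have : ((∑ i, q i * x i : ℚ) : AddCircle (1 : ℚ)) =
        ∑ i, ((q i * x i : ℚ) : AddCircle (1 : ℚ)) :=
      map_sum (QuotientAddGroup.mk' (AddSubgroup.zmultiples (1 : ℚ))) _ _
    rw [this]
    refine Finset.sum_congr rfl fun i _ => ?_
    rw [map_zsmul, ← hq, mul_comm, ← AddCircle.coe_zsmul, zsmul_eq_mul]
  have hint : ∀ z : ℚ, (z : AddCircle (1 : ℚ)) = 0 ↔ ∃ j : ℤ, z = j := fun z => by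
    rw [AddCircle.coe_eq_zero_iff]
    simp [eq_comm]
  refine ⟨q, fun f hf => ?_, fun j hj => hc ?_⟩
  · rw [← hint, ← hχ]
    have : (QuotientAddGroup.mk' (ZZ F)) f = 0 :=
      (QuotientAddGroup.eq_zero_iff f).2 (AddSubgroup.subset_closure (by exact_mod_cast hf))
    exact (congrArg c this).trans (map_zero c)
  · have h0 : χ y = 0 := by rw [hχ, hint]; exact ⟨j, hj⟩
    exact h0

theorem separated_iff {F : Finset (Fin d → ℤ)} {y : Fin d → ℤ} : Separated F y ↔ y ∉ ZZ F := by
  refine ⟨Separated.notMem, fun h => ?_⟩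
  obtain ⟨q, hF, hy⟩ := exists_rat_character h
  -- Clearing denominators turns the character into an integral functional modulo `|m|`. The
  -- remainder `r` of its value at `y` is nonzero because the rational value at `y` is not an
  -- integer.
  obtain ⟨⟨m, hm⟩, hmq⟩ := IsLocalization.exist_integer_multiples_of_finite
    (nonZeroDivisors ℤ) q
  choose w hw using hmq
  have hm0 : m ≠ 0 := nonZeroDivisors.ne_zero hm
  have hmq0 : (m : ℚ) ≠ 0 := by exact_mod_cast hm0
  have key : ∀ x : Fin d → ℤ, ((w ⬝ᵥ x : ℤ) : ℚ) = m * ∑ i, q i * x i := fun x => by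
    simp only [dotProduct, Int.cast_sum, Int.cast_mul, Finset.mul_sum]
    refine Finset.sum_congr rfl fun i _ => ?_
    have := hw i
    simp only [algebraMap_int_eq, eq_intCast, zsmul_eq_mul] at this
    rw [this]; ring
  refine ⟨w, |m|, w ⬝ᵥ y % |m|, w ⬝ᵥ y / |m|, fun f hf => ?_,
    (Int.mul_ediv_add_emod _ _).symm, ?_, Int.emod_lt_of_pos _ (abs_pos.2 hm0)⟩
  · obtain ⟨j, hj⟩ := hF f hf
    have h1 := key f
    rw [hj] at h1
    have h2 : w ⬝ᵥ f = m * j := by exact_mod_cast h1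
    obtain ⟨c, hc⟩ : |m| ∣ w ⬝ᵥ f := by rw [h2, abs_dvd]; exact dvd_mul_right m j
    exact ⟨c, hc⟩
  · refine lt_of_le_of_ne (Int.emod_nonneg _ (abs_pos.2 hm0).ne') fun h0 => ?_
    have h1 : m ∣ w ⬝ᵥ y := by rw [← abs_dvd]; exact Int.dvd_of_emod_eq_zero h0.symm
    obtain ⟨j, hj⟩ := h1
    refine hy j (mul_left_cancel₀ hmq0 ?_)
    rw [← key, hj]; push_cast; ring

/-- A certificate of `x ∉ ℕA - ℕF`: a finite set of points containing `x`, closed under subtracting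
elements of `A ∖ F` as long as a functional that is nonnegative on `A` and zero on `F` allows it,
and disjoint from `ℤF`. -/
def Avoids (A F : Finset (Fin d → ℤ)) (x : Fin d → ℤ) : Prop :=
  ∃ (w : Fin d → ℤ) (S : List (Fin d → ℤ)), (∀ f ∈ F, w ⬝ᵥ f = 0) ∧ (∀ a ∈ A, 0 ≤ w ⬝ᵥ a) ∧
    x ∈ S ∧ ∀ s ∈ S, Separated F s ∧ ∀ a ∈ A, a ∈ F ∨ w ⬝ᵥ (s - a) < 0 ∨ s - a ∈ S

/-- If `x ∈ ℕA - ℕF`, then `x - l.sum ∈ ℤF` for some list `l` in `A`. Remove the elements of `l` one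
by one: those in `F` do not matter modulo `ℤF`, and the others lead from a point of `S` to a point
of `S`. Leaving through `w < 0` is impossible, since the final value of `w` is `0` and later
subtractions cannot raise it. So some point of `S` would lie in `ℤF`. -/
theorem Avoids.not_inLocalization {A F : Finset (Fin d → ℤ)} {x : Fin d → ℤ}
    (h : Avoids A F x) : ¬ InLocalization A F x := by
  obtain ⟨w, S, hF, hA, hx, hS⟩ := h
  have hZ : ∀ y ∈ ZZ F, w ⬝ᵥ y = 0 := by
    intro y hy
    induction hy using AddSubgroup.closure_induction with
    | mem x hx => exact hF x (by exact_mod_cast hx)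
    | zero => simp
    | add x y _ _ hx hy => rw [dotProduct_add, hx, hy, add_zero]
    | neg x _ hx => rw [dotProduct_neg, hx, neg_zero]
  have key : ∀ l : List (Fin d → ℤ), (∀ v ∈ l, v ∈ A) → ∀ s ∈ S, s - l.sum ∉ ZZ F := by
    intro l
    induction l with
    | nil => intro _ s hs; simpa using (hS s hs).1.notMem
    | cons a l ih =>
      intro hl s hs hmem
      have hl' : ∀ v ∈ l, v ∈ A := fun v hv => hl v (List.mem_cons_of_mem _ hv)
      rw [List.sum_cons, ← sub_sub] at hmem
      rcases (hS s hs).2 a (hl a List.mem_cons_self) with haF | hneg | hmS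
      · refine ih hl' s hs ?_
        have haZ : a ∈ ZZ F := AddSubgroup.subset_closure (by exact_mod_cast haF)
        have := add_mem hmem haZ
        rwa [show s - a - l.sum + a = s - l.sum by abel] at this
      · have h0 := hZ _ hmem
        have h1 : 0 ≤ w ⬝ᵥ l.sum := by
          clear ih hmem h0 hl
          induction l with
          | nil => simp
          | cons b l ih =>
            rw [List.sum_cons, dotProduct_add]
            exact add_nonneg (hA b (hl' b List.mem_cons_self))
              (ih fun v hv => hl' v (List.mem_cons_of_mem _ hv))
        rw [dotProduct_sub] at h0
        omega
      · exact ih hl' _ hmS hmem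
  rintro ⟨u, hu, v, hv, huv⟩
  obtain ⟨l, hl, rfl⟩ := mem_NN_iff.1 hu
  refine key l hl x hx (mem_ZZ_iff.2 ⟨0, zero_mem _, v, hv, ?_⟩)
  rw [← huv]; abel

/-- For the converse, an exposing functional drops by at least one with every subtraction of an
element of `A ∖ F`, so after boundedly many steps it is negative. The points met on the way stay
outside `ℕA - ℕF`, which contains `ℤF`. -/
theorem IsFace.avoids_iff {A F : Finset (Fin d → ℤ)} (hF : IsFace A F) {x : Fin d → ℤ} :
    Avoids A F x ↔ ¬ InLocalization A F x := by
  refine ⟨Avoids.not_inLocalization, fun hx => ?_⟩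
  obtain ⟨w, hw⟩ := hF.exists_exposes
  have hsep : ∀ y, ¬ InLocalization A F y → Separated F y := fun y hy => by
    rw [separated_iff, mem_ZZ_iff]
    rintro ⟨u, hu, v, hv, h⟩
    exact hy ⟨u, NN_mono hF.subset hu, v, hv, h⟩
  have key : ∀ (k : ℕ) (x : Fin d → ℤ), w ⬝ᵥ x < k → ¬ InLocalization A F x →
      ∃ S : List (Fin d → ℤ), x ∈ S ∧
        ∀ s ∈ S, Separated F s ∧ ∀ a ∈ A, a ∈ F ∨ w ⬝ᵥ (s - a) < 0 ∨ s - a ∈ S := by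
    intro k
    induction k with
    | zero =>
      intro x hx hxA
      -- Since `w` is already negative at `x`, every further subtraction is excused by the sign.
      refine ⟨[x], List.mem_cons_self, fun s hs => ?_⟩
      obtain rfl := List.mem_singleton.1 hs
      refine ⟨hsep s hxA, fun a ha => ?_⟩
      rcases hw.2 a ha with h | h
      · exact Or.inl h
      · right; left
        rw [dotProduct_sub]
        push_cast at hx
        omega
    | succ k ih =>
      intro x hx hxA
      have h1 : ∀ a, ∃ S : List (Fin d → ℤ), (a ∈ A → a ∉ F → x - a ∈ S) ∧
          ∀ s ∈ S, Separated F s ∧ ∀ a ∈ A, a ∈ F ∨ w ⬝ᵥ (s - a) < 0 ∨ s - a ∈ S := by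
        intro a
        by_cases ha : a ∈ A ∧ a ∉ F
        · have hpos := (hw.2 a ha.1).resolve_left ha.2
          obtain ⟨S, hS, h⟩ := ih (x - a) (by rw [dotProduct_sub]; push_cast at hx; omega)
            fun h => hxA (by simpa using h.add (mem_NN ha.1))
          exact ⟨S, fun _ _ => hS, h⟩
        · exact ⟨[], fun h₁ h₂ => absurd ⟨h₁, h₂⟩ ha, by simp⟩
      choose S hS hS' using h1
      -- The certificate for `x` consists of `x` and the certificates of all `x - a`.
      refine ⟨x :: A.toList.flatMap S, List.mem_cons_self, fun s hs => ?_⟩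
      rcases List.mem_cons.1 hs with rfl | hs
      · refine ⟨hsep s hxA, fun a ha => ?_⟩
        by_cases haF : a ∈ F
        · exact Or.inl haF
        · right; right
          exact List.mem_cons_of_mem _ (List.mem_flatMap.2
            ⟨a, by simpa using ha, hS a ha haF⟩)
      · obtain ⟨b, hb, hs⟩ := List.mem_flatMap.1 hs
        refine ⟨(hS' b s hs).1, fun a ha => ?_⟩
        exact ((hS' b s hs).2 a ha).imp_right fun h => h.imp_right fun h =>
          List.mem_cons_of_mem _ (List.mem_flatMap.2 ⟨b, hb, h⟩)
  obtain ⟨S, hxS, hS⟩ := key (w ⬝ᵥ x + 1).toNat x (by omega) hx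
  refine ⟨w, S, hw.1, fun a ha => ?_, hxS, hS⟩
  rcases hw.2 a ha with h | h
  · exact (hw.1 a h).ge
  · exact h.le

end

section

variable {d : ℕ}

/-! ### Standard pairs -/

/-- A monomial lies in a monomial ideal exactly when one of the monomial generators divides it. The
right-hand side does not mention `k`; this is the source of the independence of the field. -/
theorem mem_stdMono_iff {k : Type*} [Field k] {A B : Finset (Fin d → ℤ)}
    (hB : ∀ b ∈ B, b ∈ NN A) {a : Fin d → ℤ} :
    a ∈ stdMono (monomialIdeal k A B) ↔ a ∈ NN A ∧ ∀ b ∈ B, a - b ∉ NN A := by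
  have h1 : ∀ h : a ∈ NN A, monomial k ⟨a, h⟩ ∈ monomialIdeal k A B ↔ ∃ b ∈ B, a - b ∈ NN A := by
    intro h
    have h2 : {x | ∃ b : NN A, (b : Fin d → ℤ) ∈ B ∧ x = monomial k b} =
        AddMonoidAlgebra.of' k (NN A) '' {b | (b : Fin d → ℤ) ∈ B} := by
      ext x
      simp only [Set.mem_ofPred_eq, Set.mem_image]
      exact exists_congr fun b => and_congr_right fun _ => eq_comm
    rw [monomialIdeal, h2, AddMonoidAlgebra.mem_ideal_span_of'_image]
    have h3 : (monomial k (⟨a, h⟩ : NN A)).coeff.support = {⟨a, h⟩} :=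
      by simp [monomial, Finsupp.support_single]
    rw [h3]
    simp only [Finset.mem_singleton, forall_eq, Set.mem_ofPred_eq]
    constructor
    · rintro ⟨⟨b, hb⟩, hbB, ⟨c, hc⟩, h⟩
      refine ⟨b, hbB, ?_⟩
      have h' : a = c + b := congrArg Subtype.val h
      rw [h', add_sub_cancel_right]
      exact hc
    · rintro ⟨b, hbB, hc⟩
      exact ⟨⟨b, hB b hbB⟩, hbB, ⟨a - b, hc⟩, Subtype.ext (sub_add_cancel a b).symm⟩
  simp only [stdMono, Set.mem_ofPred_eq]
  constructor
  · rintro ⟨h, ha⟩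
    rw [h1] at ha
    push Not at ha
    exact ⟨h, ha⟩
  · rintro ⟨h, ha⟩
    refine ⟨h, ?_⟩
    rw [h1]
    push Not
    exact ha

theorem isProperPair_iff {k : Type*} [Field k] {A B : Finset (Fin d → ℤ)}
    (hB : ∀ b ∈ B, b ∈ NN A) {p : PairData d} :
    IsProperPair (monomialIdeal k A B) p ↔
      IsPair A p ∧ ∀ b ∈ B, ¬ InLocalization A p.2 (p.1 - b) := by
  refine and_congr_right fun hp => ?_
  constructor
  · rintro h b hb ⟨u, hu, v, hv, huv⟩
    have := ((mem_stdMono_iff hB).1 (h ⟨v, hv, rfl⟩)).2 b hb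
    rw [show p.1 + v - b = p.1 - b + v by abel, huv] at this
    exact this hu
  · rintro h _ ⟨c, hc, rfl⟩
    refine (mem_stdMono_iff hB).2 ⟨add_mem hp.1 (NN_mono hp.2.subset hc), fun b hb hmem => ?_⟩
    exact h b hb ⟨_, hmem, c, hc, by abel⟩

/-- Since `a = b + g` with `g ∈ ℕG`, containment gives `g + f ∈ ℕG` for each `f ∈ F`, and the face
property puts `f` into `G`. -/
theorem subset_and_sub_mem_of_pairSet_subset {A F G : Finset (Fin d → ℤ)} (hF : F ⊆ A)
    (hG : IsFace A G) {a b : Fin d → ℤ} (h : pairSet a F ⊆ pairSet b G) :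
    F ⊆ G ∧ a - b ∈ NN G := by
  obtain ⟨g, hg, hag⟩ := h ⟨0, zero_mem _, (add_zero a).symm⟩
  refine ⟨fun f hf => ?_, by rwa [hag, add_sub_cancel_left]⟩
  obtain ⟨g', hg', hfg⟩ := h ⟨f, mem_NN hf, rfl⟩
  refine hG.mem_of_add_mem (hF hf) (NN_mono hG.subset hg) ?_
  rw [hag, add_assoc, add_right_inj] at hfg
  rw [add_comm, hfg]
  exact hg'

theorem pairSet_subset {F G : Finset (Fin d → ℤ)} {a b : Fin d → ℤ} (h : F ⊆ G)
    (hab : a - b ∈ NN G) : pairSet a F ⊆ pairSet b G := by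
  rintro _ ⟨c, hc, rfl⟩
  exact ⟨a - b + c, add_mem hab (NN_mono h hc), by abel⟩

/-- Standard pairs, in terms of (non-)membership in localizations. -/
structure IsStandard (A B : Finset (Fin d → ℤ)) (p : PairData d) : Prop where
  isFace : IsFace A p.2
  mem : InLocalization A ∅ p.1
  proper : ∀ b ∈ B, ¬ InLocalization A p.2 (p.1 - b)
  minimal : ∀ f ∈ p.2, ¬ InLocalization A ∅ (p.1 - f)
  maximal : ∀ G, IsFace A G → p.2 ⊂ G → ∃ b ∈ B, InLocalization A G (p.1 - b)

/-- Two enlargements of `(a, F)` suffice to test maximality: moving the base point back by one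
element of `F`, and replacing `F` by a larger face with the same base point. -/
theorem mem_stdPairs_iff {k : Type*} [Field k] {A B : Finset (Fin d → ℤ)}
    (hA : IsConfiguration A) (hB : ∀ b ∈ B, b ∈ NN A) {p : PairData d} :
    p ∈ stdPairs (monomialIdeal k A B) ↔ IsStandard A B p := by
  simp only [stdPairs, Set.mem_ofPred_eq, isProperPair_iff hB]
  constructor
  · rintro ⟨⟨⟨hp, hF⟩, hprop⟩, hmax⟩
    refine ⟨hF, inLocalization_empty.2 hp, hprop, fun f hf hfA => ?_, fun G hG hFG => ?_⟩
    · rw [inLocalization_empty] at hfA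
      have := hmax (p.1 - f, p.2) ⟨⟨hfA, hF⟩, fun b hb h => hprop b hb ?_⟩
        (pairSet_subset subset_rfl (by simpa using mem_NN hf))
      · have h1 : p.1 - f = p.1 := congrArg Prod.fst this
        rw [sub_eq_self] at h1
        exact hA.zero_notMem (h1 ▸ hF.subset hf)
      · have := h.add (mem_NN (hF.subset hf))
        rwa [show p.1 - f - b + f = p.1 - b by abel] at this
    · by_contra hcon
      push Not at hcon
      have := hmax (p.1, G) ⟨⟨hp, hG⟩, hcon⟩ (pairSet_subset hFG.1 (by simp [zero_mem]))
      have h1 : G = p.2 := congrArg Prod.snd this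
      exact hFG.2 h1.le
  · rintro ⟨hF, hp, hprop, hmin, hmax⟩
    refine ⟨⟨⟨inLocalization_empty.1 hp, hF⟩, hprop⟩, ?_⟩
    rintro ⟨b, G⟩ ⟨⟨hb, hG⟩, hbG⟩ hpq
    obtain ⟨hFG, hg⟩ := subset_and_sub_mem_of_pairSet_subset hF.subset hG hpq
    -- If `G` were larger, then `(p.1, G)` would meet the ideal, and so would `(b, G)`, because `p.1
    -- - b ∈ ℕG` is absorbed by the localization at `G`.
    have hGF : G = p.2 := by
      by_contra hne
      obtain ⟨b', hb', hloc⟩ := hmax G hG (hFG.ssubset_of_ne (Ne.symm hne))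
      refine hbG b' hb' ?_
      have := hloc.sub hg
      rwa [show p.1 - b' - (p.1 - b) = b - b' by abel] at this
    subst hGF
    -- Now `p.1 - b` is a sum of elements of `F`; if there is a first summand, moving back by it
    -- alone already contradicts `hmin`.
    obtain ⟨l, hl, hsum⟩ := mem_NN_iff.1 hg
    cases l with
    | nil =>
      rw [List.sum_nil, eq_comm, sub_eq_zero] at hsum
      exact Prod.ext hsum.symm rfl
    | cons f l =>
      exfalso
      refine hmin f (hl f List.mem_cons_self) (inLocalization_empty.2 ?_)
      rw [List.sum_cons] at hsum
      have h1 : p.1 - f = b + l.sum := by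
        rw [show p.1 = b + (p.1 - b) by abel, ← hsum]; abel
      rw [h1]
      exact add_mem hb (NN_mono hF.subset (list_sum_mem fun v hv =>
        mem_NN (hl v (List.mem_cons_of_mem _ hv))))

theorem divides_iff {A : Finset (Fin d → ℤ)} {p q : PairData d} (hp : IsPair A p)
    (hq : IsPair A q) : Divides A p q ↔ p.2 ⊆ q.2 ∧ InLocalization A q.2 (q.1 - p.1) := by
  constructor
  · rintro ⟨c, hc, h⟩
    obtain ⟨hFG, hg⟩ := subset_and_sub_mem_of_pairSet_subset hp.2.subset hq.2 h
    exact ⟨hFG, c, hc, _, hg, by abel⟩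
  · rintro ⟨hFG, u, hu, v, hv, h⟩
    refine ⟨u, hu, pairSet_subset hFG ?_⟩
    rw [← h, show p.1 + (q.1 - p.1 + v) - q.1 = v by abel]
    exact hv

/-! ### Decompositions of `ℕA` into translates of free submonoids -/

/-- A face of `A` that contains all divisors of `s` in `A`, and whose elements divide multiples
of `s`. -/
theorem exists_isFace_divides (A : Finset (Fin d → ℤ)) (s : Fin d → ℤ) :
    ∃ G, IsFace A G ∧ (∀ g ∈ A, s - g ∈ NN A → g ∈ G) ∧
      ∀ v ∈ NN G, ∃ N : ℕ, N • s - v ∈ NN A := by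
  classical
  -- Dividing some multiple of `s` is inherited by divisors, which is the semigroup criterion for a
  -- face.
  let G := A.filter fun g => ∃ N : ℕ, N • s - g ∈ NN A
  have hG : ∀ v ∈ NN G, ∃ N : ℕ, N • s - v ∈ NN A := by
    intro v hv
    induction hv using AddSubmonoid.closure_induction with
    | mem x hx => exact (Finset.mem_filter.1 (Finset.mem_coe.1 hx)).2
    | zero => exact ⟨0, by simp [zero_mem]⟩
    | add x y _ _ hx hy =>
      obtain ⟨N, hN⟩ := hx
      obtain ⟨M, hM⟩ := hy
      refine ⟨N + M, ?_⟩
      have := add_mem hN hM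
      rwa [show N • s - x + (M • s - y) = (N + M) • s - (x + y) by rw [add_smul]; abel] at this
  refine ⟨G, isFace_of_forall (Finset.filter_subset _ _) fun a ha haG u hu hau => haG ?_,
    fun g hg h => Finset.mem_filter.2 ⟨hg, 1, by simpa using h⟩, hG⟩
  obtain ⟨N, hN⟩ := hG _ hau
  refine Finset.mem_filter.2 ⟨ha, N, ?_⟩
  have := add_mem hN hu
  rwa [show N • s - (a + u) + u = N • s - a by abel] at this

/-- The exponent in `ℤ^d` of a monomial in variables indexed by `A`. -/
def expo {A : Finset (Fin d → ℤ)} (n : A → ℕ) : Fin d → ℤ := ∑ a, n a • (a : Fin d → ℤ)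

theorem expo_add {A : Finset (Fin d → ℤ)} (m n : A → ℕ) : expo (m + n) = expo m + expo n := by
  simp [expo, add_smul, Finset.sum_add_distrib]

theorem expo_single {A : Finset (Fin d → ℤ)} (a : A) : expo (Pi.single a 1) = (a : Fin d → ℤ) := by
  simp [expo, Pi.single_apply, ite_smul]

theorem expo_mem {A : Finset (Fin d → ℤ)} (n : A → ℕ) : expo n ∈ NN A :=
  sum_mem fun a _ => nsmul_mem (mem_NN a.2) _

theorem expo_sub_mem {A : Finset (Fin d → ℤ)} {n : A → ℕ} {a : A} (h : 1 ≤ n a) :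
    expo n - a ∈ NN A := by
  have h1 : n = (n - Pi.single a 1) + Pi.single a 1 := by
    refine (tsub_add_cancel_of_le fun b => ?_).symm
    by_cases hb : b = a
    · subst hb; simpa using h
    · simp [hb]
  rw [h1, expo_add, expo_single, add_sub_cancel_right]
  exact expo_mem _

/-- Dickson's lemma: `J` has finitely many minimal elements, and `K` bounds all their coordinates.
The requirement `1 ≤ K` is there so that a coordinate that is at least `K` is positive. -/
theorem exists_bound_minimal {ι : Type*} [Finite ι] (J : Set (ι → ℕ)) :
    ∃ K, 1 ≤ K ∧ ∀ n ∈ J, ∃ e ∈ J, e ≤ n ∧ ∀ i, e i ≤ K := by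
  cases nonempty_fintype ι
  have hfin : {e | Minimal (· ∈ J) e}.Finite :=
    WellQuasiOrderedLE.finite_of_isAntichain (setOfPred_minimal_antichain (· ∈ J))
  refine ⟨∑ e ∈ hfin.toFinset, ∑ i, e i + 1, by omega, fun n hn => ?_⟩
  obtain ⟨e, hen, he⟩ := exists_minimal_le_of_wellFoundedLT (· ∈ J) n hn
  refine ⟨e, he.1, hen, fun i => ?_⟩
  have h1 : e i ≤ ∑ i, e i := Finset.single_le_sum (fun _ _ => Nat.zero_le _) (Finset.mem_univ i)
  have h2 : ∑ i, e i ≤ ∑ e ∈ hfin.toFinset, ∑ i, e i :=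
    Finset.single_le_sum (f := fun e : ι → ℕ => ∑ i, e i) (fun _ _ => Nat.zero_le _)
      (hfin.mem_toFinset.2 he)
  omega

/-- Certificates that there are no `F`-standard points in `x + ℕT` except those in `P`. -/
inductive IsLeaf (A B F : Finset (Fin d → ℤ)) (P : (Fin d → ℤ) → Prop) (x : Fin d → ℤ)
    (T : Finset (Fin d → ℤ)) : Prop
  | mem_ideal (b : Fin d → ℤ) : b ∈ B → InLocalization A F (x - b) → IsLeaf A B F P x T
  | not_minimal (f : Fin d → ℤ) : f ∈ F → InLocalization A ∅ (x - f) → IsLeaf A B F P x T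
  | not_maximal (G : Finset (Fin d → ℤ)) : IsFace A G → F ⊂ G → T ⊆ G →
      (∀ b ∈ B, ¬ InLocalization A G (x - b)) → IsLeaf A B F P x T
  | point : T = ∅ → P x → IsLeaf A B F P x T

/-- A finite list of nodes `x + ℕT`, closed under splitting the nodes that are not leaves. -/
def IsTree (leaf : (Fin d → ℤ) → Finset (Fin d → ℤ) → Prop)
    (E : List (PairData d)) : Prop :=
  ∀ p ∈ E, leaf p.1 p.2 ∨ ∃ t ∈ p.2, ∃ q ∈ E, ∃ r ∈ E, q.1 = p.1 + t ∧ q.2 = p.2 ∧ r.1 = p.1 ∧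
    (∀ s ∈ p.2, s = t ∨ s ∈ r.2) ∧ r.2 ⊂ p.2

/-- Follow `a` through the nodes, written as `x` plus a list `l` in `T`. At a split along `t`,
either one occurrence of `t` in `l` moves into `x`, or `t` is not in `l` and `T` shrinks; `l.length
+ T.card` drops, so no acyclicity of `E` is needed. At a leaf, the obstruction at `x` passes to `a`:
being in the ideal or not minimal is preserved by adding elements of `ℕA`, and failure of maximality
by adding elements of `ℕT ⊆ ℕG`. -/
theorem IsTree.of_isStandard {A B F : Finset (Fin d → ℤ)} {P : (Fin d → ℤ) → Prop}
    {E : List (PairData d)} (hE : IsTree (IsLeaf A B F P) E) (h0 : (0, A) ∈ E)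
    {a : Fin d → ℤ} (ha : IsStandard A B (a, F)) : P a := by
  have key : ∀ (k : ℕ) (p : PairData d) (l : List (Fin d → ℤ)), p ∈ E → p.2 ⊆ A →
      (∀ v ∈ l, v ∈ p.2) → a = p.1 + l.sum → l.length + p.2.card ≤ k → P a := by
    intro k
    induction k with
    | zero =>
      intro p l hp hpA hl hal hk
      have hT : p.2 = ∅ := Finset.card_eq_zero.1 (by omega)
      have hl0 : l = [] := List.length_eq_zero_iff.1 (by omega)
      have hax : a = p.1 := by simpa [hl0] using hal
      rcases hE p hp with h | ⟨t, ht, -⟩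
      · subst hax
        cases h with
        | mem_ideal b hb h => exact absurd h (ha.proper b hb)
        | not_minimal f hf h => exact absurd h (ha.minimal f hf)
        | not_maximal G hG hFG _ h =>
          obtain ⟨b, hb, hloc⟩ := ha.maximal G hG hFG
          exact absurd hloc (h b hb)
        | point _ h => exact h
      · simp [hT] at ht
    | succ k ih =>
      intro p l hp hpA hl hal hk
      have hlA : l.sum ∈ NN A := mem_NN_iff.2 ⟨l, fun v hv => hpA (hl v hv), rfl⟩
      rcases hE p hp with h | ⟨t, ht, q, hq, r, hr, hq1, hq2, hr1, hcov, hlt⟩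
      · cases h with
        | mem_ideal b hb h =>
          refine absurd ?_ (ha.proper b hb)
          have := h.add hlA
          rwa [show p.1 - b + l.sum = a - b by rw [hal]; abel] at this
        | not_minimal f hf h =>
          refine absurd ?_ (ha.minimal f hf)
          have := h.add hlA
          rwa [show p.1 - f + l.sum = a - f by rw [hal]; abel] at this
        | not_maximal G hG hFG hTG h =>
          obtain ⟨b, hb, hloc⟩ := ha.maximal G hG hFG
          refine absurd ?_ (h b hb)
          have := hloc.sub (mem_NN_iff.2 ⟨l, fun v hv => hTG (hl v hv), rfl⟩)
          rwa [show (a, F).1 - b - l.sum = p.1 - b by simp only [hal]; abel] at this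
        | point hT h =>
          have hl0 : l = [] := List.eq_nil_iff_forall_not_mem.2 fun v hv => by
            simpa [hT] using hl v hv
          rwa [show a = p.1 by simpa [hl0] using hal]
      · by_cases htl : t ∈ l
        · refine ih q (l.erase t) hq (hq2 ▸ hpA) (fun v hv => hq2 ▸ hl v (List.mem_of_mem_erase hv))
            ?_ ?_
          · rw [hal, hq1, add_assoc, List.sum_erase htl]
          · have := List.length_erase_of_mem htl
            have := List.length_pos_of_mem htl
            rw [hq2]; omega
        · refine ih r l hr (hlt.1.trans hpA) (fun v hv => ?_) (hr1 ▸ hal) ?_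
          · rcases hcov v (hl v hv) with rfl | h
            · exact absurd hv htl
            · exact h
          · have := Finset.card_lt_card hlt
            omega
  obtain ⟨l, hl, hsum⟩ := mem_NN_iff.1 (inLocalization_empty.1 ha.mem)
  exact key _ (0, A) l h0 subset_rfl hl (by simp [hsum]) le_rfl

/-- Finite binary trees of translates of free submonoids. -/
inductive Decomposes (leaf : (Fin d → ℤ) → Finset (Fin d → ℤ) → Prop) :
    (Fin d → ℤ) → Finset (Fin d → ℤ) → Prop
  | leaf (x : Fin d → ℤ) (T : Finset (Fin d → ℤ)) : leaf x T → Decomposes leaf x T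
  | split (x t : Fin d → ℤ) (T : Finset (Fin d → ℤ)) : t ∈ T → Decomposes leaf (x + t) T →
      Decomposes leaf x (T.erase t) → Decomposes leaf x T

theorem Decomposes.exists_isTree {leaf : (Fin d → ℤ) → Finset (Fin d → ℤ) → Prop}
    {x : Fin d → ℤ} {T : Finset (Fin d → ℤ)} (h : Decomposes leaf x T) :
    ∃ E, (x, T) ∈ E ∧ IsTree leaf E := by
  induction h with
  | leaf x T h =>
    refine ⟨[(x, T)], List.mem_cons_self, fun p hp => Or.inl ?_⟩
    obtain rfl := List.mem_singleton.1 hp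
    exact h
  | split x t T ht _ _ ih₁ ih₂ =>
    obtain ⟨E₁, h₁, hE₁⟩ := ih₁
    obtain ⟨E₂, h₂, hE₂⟩ := ih₂
    refine ⟨(x, T) :: (E₁ ++ E₂), List.mem_cons_self, fun p hp => ?_⟩
    rcases List.mem_cons.1 hp with rfl | hp
    · refine Or.inr ⟨t, ht, (x + t, T), by simp [h₁], (x, T.erase t), by simp [h₂], rfl, rfl, rfl,
        fun s hs => ?_, Finset.erase_ssubset ht⟩
      by_cases hst : s = t
      · exact Or.inl hst
      · exact Or.inr (Finset.mem_erase.2 ⟨hst, hs⟩)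
    · rcases List.mem_append.1 hp with hp | hp
      · refine (hE₁ p hp).imp_right ?_
        rintro ⟨t, ht, q, hq, r, hr, h⟩
        exact ⟨t, ht, q, by simp [hq], r, by simp [hr], h⟩
      · refine (hE₂ p hp).imp_right ?_
        rintro ⟨t, ht, q, hq, r, hr, h⟩
        exact ⟨t, ht, q, by simp [hq], r, by simp [hr], h⟩

/-- Always split along some `t` with `n t < K`. Raising `n t` and erasing `t` both decrease the sum
of the deficits. -/
theorem decomposes_of_bound {A : Finset (Fin d → ℤ)}
    {leaf : (Fin d → ℤ) → Finset (Fin d → ℤ) → Prop} (K : ℕ)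
    (hleaf : ∀ (n : A → ℕ) (T : Finset A), (∀ t ∈ T, K ≤ n t) →
      leaf (expo n) (T.map (Function.Embedding.subtype _))) :
    ∀ (k : ℕ) (n : A → ℕ) (T : Finset A), ∑ t ∈ T, (K + 1 - n t) < k →
      Decomposes leaf (expo n) (T.map (Function.Embedding.subtype _)) := by
  intro k
  induction k with
  | zero => intro n T h; omega
  | succ k ih =>
    intro n T h
    by_cases hT : ∀ t ∈ T, K ≤ n t
    · exact .leaf _ _ (hleaf n T hT)
    push Not at hT
    obtain ⟨t, ht, hnt⟩ := hT
    refine .split _ (t : Fin d → ℤ) _ (Finset.mem_map_of_mem _ ht) ?_ ?_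
    · rw [← expo_single, ← expo_add]
      refine ih _ _ (lt_of_lt_of_le (Finset.sum_lt_sum (fun s _ => ?_) ⟨t, ht, ?_⟩)
        (Nat.lt_succ_iff.1 h))
      · simp only [Pi.add_apply]; omega
      · simp only [Pi.add_apply, Pi.single_eq_same]; omega
    · have := ih n (T.erase t) (by
        have h1 := Finset.add_sum_erase T (fun t => K + 1 - n t) ht
        omega)
      rwa [Finset.map_erase] at this

/-- Lift to exponent vectors in `ℕ^A`, where the ideal localized at `F` becomes an up-set `J`, and
let `K` be its Dickson bound. Once all coordinates of `n` in `T` are at least `K`, raising them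
further cannot bring `n` into `J`. So if `n ∉ J`, the ideal is avoided by `(x, G)`, where `x = expo
n` and `G` is the face spanned by `T` and `F`. If `G ≠ F`, maximality fails along the whole piece.
If `G = F` and `T` is nonempty, minimality fails. Otherwise the piece is one point. -/
theorem exists_isTree {A B F : Finset (Fin d → ℤ)} (hF : IsFace A F) :
    ∃ E, (0, A) ∈ E ∧ IsTree (IsLeaf A B F fun x => IsStandard A B (x, F)) E := by
  classical
  let J : Set (A → ℕ) := {n | ∃ b ∈ B, InLocalization A F (expo n - b)}
  have hJ : ∀ e ∈ J, ∀ n, e ≤ n → n ∈ J := by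
    rintro e ⟨b, hb, he⟩ n hen
    refine ⟨b, hb, ?_⟩
    have := he.add (expo_mem (n - e))
    rwa [show expo e - b + expo (n - e) = expo e + expo (n - e) - b by abel, ← expo_add,
      add_tsub_cancel_of_le hen] at this
  obtain ⟨K, hK, hKJ⟩ := exists_bound_minimal J
  have hleaf : ∀ (n : A → ℕ) (T : Finset A), (∀ t ∈ T, K ≤ n t) →
      IsLeaf A B F (fun x => IsStandard A B (x, F)) (expo n)
        (T.map (Function.Embedding.subtype _)) := by
    intro n T hT
    by_cases hnJ : n ∈ J
    · obtain ⟨b, hb, h⟩ := hnJ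
      exact .mem_ideal b hb h
    let sT : Fin d → ℤ := ∑ t ∈ T, (t : Fin d → ℤ)
    let sF : Fin d → ℤ := ∑ f ∈ F, f
    have hsT : sT ∈ NN A := sum_mem fun t _ => mem_NN t.2
    have hsF : sF ∈ NN F := sum_mem fun f hf => mem_NN hf
    obtain ⟨G, hG, hdvd, hGs⟩ := exists_isFace_divides A (sT + sF)
    have hFG : F ⊆ G := fun f hf => by
      refine hdvd f (hF.subset hf) ?_
      have : sT + sF - f = sT + ∑ x ∈ F.erase f, x := by
        simp only [sF]; rw [← Finset.add_sum_erase F _ hf]; abel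
      rw [this]
      exact add_mem hsT (sum_mem fun x hx => mem_NN (hF.subset (Finset.mem_of_mem_erase hx)))
    have hTG : ∀ t ∈ T, (t : Fin d → ℤ) ∈ G := fun t ht => by
      refine hdvd t t.2 ?_
      have : sT + sF - t = (∑ x ∈ T.erase t, (x : Fin d → ℤ)) + sF := by
        simp only [sT]; rw [← Finset.add_sum_erase T _ ht]; abel
      rw [this]
      exact add_mem (sum_mem fun x _ => mem_NN x.2) (NN_mono hF.subset hsF)
    have hnG : ∀ b ∈ B, ¬ InLocalization A G (expo n - b) := by
      rintro b hb ⟨u, hu, v, hv, huv⟩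
      obtain ⟨N, hN⟩ := hGs v hv
      -- As `v` divides `N • (sT + sF)`, it can be traded for `N` copies of each element of `T`,
      -- plus an element of `ℕF` that the localization ignores.
      let m : A → ℕ := fun a => if a ∈ T then N else 0
      have hm : expo m = N • sT := by
        simp only [expo, m, sT, Finset.smul_sum, ite_smul, zero_smul]
        rw [Finset.sum_ite_mem, Finset.univ_inter]
      have hnm : n + m ∈ J := by
        refine ⟨b, hb, u + (N • (sT + sF) - v), add_mem hu hN, N • sF, nsmul_mem hsF N, ?_⟩
        rw [expo_add, hm, ← huv, smul_add]; abel
      obtain ⟨e, he, hen, heK⟩ := hKJ _ hnm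
      refine hnJ (hJ e he n fun a => ?_)
      by_cases haT : a ∈ T
      · exact (heK a).trans (hT a haT)
      · simpa [m, haT] using hen a
    by_cases hGF : G = F
    · subst hGF
      rcases T.eq_empty_or_nonempty with rfl | ⟨t, ht⟩
      · rw [Finset.map_empty]
        by_cases hmin : ∃ f ∈ G, InLocalization A ∅ (expo n - f)
        · obtain ⟨f, hf, h⟩ := hmin
          exact .not_minimal f hf h
        by_cases hmax : ∃ H, IsFace A H ∧ G ⊂ H ∧ ∀ b ∈ B, ¬ InLocalization A H (expo n - b)
        · obtain ⟨H, hH, hGH, h⟩ := hmax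
          exact .not_maximal H hH hGH (Finset.empty_subset _) h
        push Not at hmin hmax
        exact .point rfl ⟨hF, inLocalization_empty.2 (expo_mem n), hnG, hmin, hmax⟩
      -- Here `T ⊆ F`, and `n t ≥ K ≥ 1` means that `t` can be subtracted.
      · exact .not_minimal t (hTG t ht)
          (inLocalization_empty.2 (expo_sub_mem (hK.trans (hT t ht))))
    · refine .not_maximal G hG (hFG.ssubset_of_ne (Ne.symm hGF)) (fun x hx => ?_) hnG
      obtain ⟨t, ht, rfl⟩ := Finset.mem_map.1 hx
      exact hTG t ht
  have h := decomposes_of_bound K hleaf _ (0 : A → ℕ) Finset.univ (Nat.lt_succ_self _)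
  have h0 : expo (0 : A → ℕ) = 0 := by simp [expo]
  have hA : (Finset.univ : Finset A).map (Function.Embedding.subtype _) = A := by
    ext x; simp
  rw [h0, hA] at h
  exact h.exists_isTree

theorem finite_isStandard (A B : Finset (Fin d → ℤ)) : {p | IsStandard A B p}.Finite := by
  have h : ∀ F : Finset (Fin d → ℤ), {p | IsStandard A B p ∧ p.2 = F}.Finite := by
    intro F
    by_cases hF : IsFace A F
    · obtain ⟨E, h0, hE⟩ := exists_isTree (B := B) hF
      -- A point leaf is itself a node of the finite list `E`; with this as the leaf predicate, the
      -- tree bounds the set of standard base points.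
      have hE' : IsTree (IsLeaf A B F fun x => (x, ∅) ∈ E) E := by
        intro p hp
        refine (hE p hp).imp_left fun h => ?_
        cases h with
        | mem_ideal b hb h => exact .mem_ideal b hb h
        | not_minimal f hf h => exact .not_minimal f hf h
        | not_maximal G hG hFG hTG h => exact .not_maximal G hG hFG hTG h
        | point hT h => exact .point hT (by rw [← hT]; exact hp)
      refine ((E.toFinset.image fun p => (p.1, F)).finite_toSet).subset ?_
      rintro ⟨a, F'⟩ ⟨ha, rfl⟩
      simp only [Finset.coe_image, Set.mem_image, Finset.mem_coe, List.mem_toFinset]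
      exact ⟨(a, ∅), hE'.of_isStandard h0 ha, rfl⟩
    · refine Set.finite_empty.subset ?_
      rintro p ⟨hp, rfl⟩
      exact hF hp.isFace
  refine (A.powerset.finite_toSet.biUnion fun F _ => h F).subset fun p hp => ?_
  simp only [Set.mem_iUnion]
  exact ⟨p.2, by simpa using hp.isFace.subset, hp, rfl⟩

end

section

variable {d : ℕ}

/-! ### Certificates for the output -/

/-- A certificate that `Φ` lists the faces of `A`: each subset of `A` is in a list `Λ`, and each
member of `Λ` is either in `Φ` or violates the defining property of a face. -/
def ListsFaces (A : Finset (Fin d → ℤ)) (Φ : List (Finset (Fin d → ℤ))) : Prop :=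
  (∀ F ∈ Φ, IsFace A F) ∧ ∃ Λ : List (Finset (Fin d → ℤ)), ∅ ∈ Λ ∧ ∀ F ∈ Λ,
    (∀ a ∈ A, insert a F ∈ Λ) ∧ (F ∈ Φ ∨ ∃ a ∈ A, a ∉ F ∧ InLocalization A F (0 - a))

theorem IsFace.mem_of_inLocalization {A F : Finset (Fin d → ℤ)} (h : IsFace A F)
    {a : Fin d → ℤ} (ha : a ∈ A) (hloc : InLocalization A F (0 - a)) : a ∈ F := by
  obtain ⟨u, hu, v, hv, huv⟩ := hloc
  refine h.mem_of_add_mem ha hu ?_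
  rw [← huv, show a + (0 - a + v) = v by abel]
  exact hv

/-- `Λ` contains `∅` and is closed under inserting elements of `A`, so every subset of `A` is
judged; a face cannot be refuted. -/
theorem ListsFaces.mem_iff {A : Finset (Fin d → ℤ)} {Φ : List (Finset (Fin d → ℤ))}
    (h : ListsFaces A Φ) {F : Finset (Fin d → ℤ)} : F ∈ Φ ↔ IsFace A F := by
  obtain ⟨h₁, Λ, h0, hΛ⟩ := h
  refine ⟨h₁ F, fun hF => ?_⟩
  have key : ∀ G : Finset (Fin d → ℤ), G ⊆ A → G ∈ Λ := by
    intro G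
    induction G using Finset.induction_on with
    | empty => exact fun _ => h0
    | insert a G _ ih =>
      intro hG
      rw [Finset.insert_subset_iff] at hG
      exact (hΛ G (ih hG.2)).1 a hG.1
  rcases (hΛ F (key F hF.subset)).2 with h | ⟨a, ha, haF, hloc⟩
  · exact h
  · exact absurd (hF.mem_of_inLocalization ha hloc) haF

theorem exists_listsFaces (A : Finset (Fin d → ℤ)) : ∃ Φ, ListsFaces A Φ := by
  classical
  refine ⟨(A.powerset.filter (IsFace A)).toList, fun F hF => ?_, A.powerset.toList, by simp,
    fun F hF => ⟨fun a ha => ?_, ?_⟩⟩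
  · rw [Finset.mem_toList, Finset.mem_filter] at hF
    exact hF.2
  · rw [Finset.mem_toList, Finset.mem_powerset] at hF ⊢
    exact Finset.insert_subset ha hF
  · rw [Finset.mem_toList, Finset.mem_powerset] at hF
    rw [Finset.mem_toList, Finset.mem_filter, Finset.mem_powerset]
    by_contra hcon
    push Not at hcon
    refine hcon.1 hF (isFace_of_forall hF fun a ha haF u hu hau => ?_)
    exact hcon.2 a ha haF ⟨u, hu, a + u, hau, by abel⟩

/-- A certificate that `p` is a standard pair, where `Φ` lists the faces of `A`. -/
def StandardCert (A B : Finset (Fin d → ℤ)) (Φ : List (Finset (Fin d → ℤ)))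
    (p : PairData d) : Prop :=
  p.2 ∈ Φ ∧ InLocalization A ∅ p.1 ∧ (∀ b ∈ B, Avoids A p.2 (p.1 - b)) ∧
    (∀ f ∈ p.2, Avoids A ∅ (p.1 - f)) ∧
    ∀ G ∈ Φ, ¬ p.2 ⊂ G ∨ ∃ b ∈ B, InLocalization A G (p.1 - b)

/-- `Avoids` is sound for arbitrary sets but complete only for faces. For the minimality clause that
face is `∅`, which is where strong convexity and `0 ∉ A` are used. -/
theorem ListsFaces.standardCert_iff {A B : Finset (Fin d → ℤ)} {Φ : List (Finset (Fin d → ℤ))}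
    (hΦ : ListsFaces A Φ) (hA : IsConfiguration A) {p : PairData d} :
    StandardCert A B Φ p ↔ IsStandard A B p := by
  constructor
  · rintro ⟨h₁, h₂, h₃, h₄, h₅⟩
    exact ⟨hΦ.mem_iff.1 h₁, h₂, fun b hb => (h₃ b hb).not_inLocalization,
      fun f hf => (h₄ f hf).not_inLocalization,
      fun G hG hFG => (h₅ G (hΦ.mem_iff.2 hG)).resolve_left (not_not_intro hFG)⟩
  · rintro ⟨h₁, h₂, h₃, h₄, h₅⟩
    refine ⟨hΦ.mem_iff.2 h₁, h₂, fun b hb => h₁.avoids_iff.2 (h₃ b hb),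
      fun f hf => hA.isFace_empty.avoids_iff.2 (h₄ f hf), fun G hG => ?_⟩
    by_cases hFG : p.2 ⊂ G
    · exact Or.inr (h₅ G (hΦ.mem_iff.1 hG) hFG)
    · exact Or.inl hFG

/-- A certificate for a leaf, where `Φ` lists the faces of `A`. -/
def LeafCert (A B : Finset (Fin d → ℤ)) (Φ : List (Finset (Fin d → ℤ)))
    (L : List (PairData d)) (F : Finset (Fin d → ℤ)) (x : Fin d → ℤ)
    (T : Finset (Fin d → ℤ)) : Prop :=
  (∃ b ∈ B, InLocalization A F (x - b)) ∨ (∃ f ∈ F, InLocalization A ∅ (x - f)) ∨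
    (∃ G ∈ Φ, F ⊂ G ∧ T ⊆ G ∧ ∀ b ∈ B, Avoids A G (x - b)) ∨ T = ∅ ∧ (x, F) ∈ L

theorem ListsFaces.leafCert_iff {A B : Finset (Fin d → ℤ)} {Φ : List (Finset (Fin d → ℤ))}
    (hΦ : ListsFaces A Φ) {L : List (PairData d)} {F : Finset (Fin d → ℤ)} {x : Fin d → ℤ}
    {T : Finset (Fin d → ℤ)} :
    LeafCert A B Φ L F x T ↔ IsLeaf A B F (fun x => (x, F) ∈ L) x T := by
  constructor
  · rintro (⟨b, hb, h⟩ | ⟨f, hf, h⟩ | ⟨G, hG, hFG, hTG, h⟩ | ⟨hT, h⟩)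
    · exact .mem_ideal b hb h
    · exact .not_minimal f hf h
    · exact .not_maximal G (hΦ.mem_iff.1 hG) hFG hTG fun b hb => (h b hb).not_inLocalization
    · exact .point hT h
  · rintro (⟨b, hb, h⟩ | ⟨f, hf, h⟩ | ⟨G, hG, hFG, hTG, h⟩ | ⟨hT, h⟩)
    · exact Or.inl ⟨b, hb, h⟩
    · exact Or.inr (Or.inl ⟨f, hf, h⟩)
    · exact Or.inr (Or.inr (Or.inl ⟨G, hΦ.mem_iff.2 hG, hFG, hTG,
        fun b hb => hG.avoids_iff.2 (h b hb)⟩))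
    · exact Or.inr (Or.inr (Or.inr ⟨hT, h⟩))

/-- A certificate that `L` lists the standard pairs. -/
def ListsStandard (A B : Finset (Fin d → ℤ)) (L : List (PairData d)) : Prop :=
  ∃ Φ, ListsFaces A Φ ∧ (∀ p ∈ L, StandardCert A B Φ p) ∧
    ∀ F ∈ Φ, ∃ E, (0, A) ∈ E ∧ IsTree (LeafCert A B Φ L F) E

/-- Soundness of the entries and completeness of the list are certified separately, the latter by
one tree for each face. -/
theorem listsStandard_iff {A B : Finset (Fin d → ℤ)} (hA : IsConfiguration A)
    {L : List (PairData d)} : ListsStandard A B L ↔ ∀ p, p ∈ L ↔ IsStandard A B p := by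
  constructor
  · rintro ⟨Φ, hΦ, hL, hE⟩ p
    refine ⟨fun hp => (hΦ.standardCert_iff hA).1 (hL p hp), fun hp => ?_⟩
    obtain ⟨E, h0, hE⟩ := hE p.2 (hΦ.mem_iff.2 hp.isFace)
    have hE' : IsTree (IsLeaf A B p.2 fun x => (x, p.2) ∈ L) E :=
      fun q hq => (hE q hq).imp_left hΦ.leafCert_iff.1
    exact hE'.of_isStandard h0 hp
  · intro h
    obtain ⟨Φ, hΦ⟩ := exists_listsFaces A
    refine ⟨Φ, hΦ, fun p hp => (hΦ.standardCert_iff hA).2 ((h p).1 hp), fun F hF => ?_⟩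
    obtain ⟨E, h0, hE⟩ := exists_isTree (B := B) (hΦ.mem_iff.1 hF)
    refine ⟨E, h0, fun q hq => (hE q hq).imp_left fun hleaf => hΦ.leafCert_iff.2 ?_⟩
    simpa only [h] using hleaf

/-- The lists `C` and `D` have the same elements. -/
def SameElems {α : Type*} (C D : List α) : Prop := (∀ q ∈ C, q ∈ D) ∧ ∀ q ∈ D, q ∈ C

theorem sameElems_iff {α : Type*} {C D : List α} :
    SameElems C D ↔ {q | q ∈ C} = {q | q ∈ D} := by
  rw [Set.Subset.antisymm_iff]
  rfl

/-- `L` lists the elements of `𝒮`, each as a list, without repetitions. -/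
structure Enumerates {α : Type*} (L : List (List α)) (𝒮 : Set (Set α)) : Prop where
  nodup : ∀ C ∈ L, C.Nodup
  pairwise : L.Pairwise fun C D => ¬ SameElems C D
  mem : ∀ C ∈ L, {q | q ∈ C} ∈ 𝒮
  exists_mem : ∀ s ∈ 𝒮, ∃ C ∈ L, {q | q ∈ C} = s

theorem exists_enumerates {α : Type*} {S : Set α} (hS : S.Finite) {𝒮 : Set (Set α)}
    (h𝒮 : ∀ s ∈ 𝒮, s ⊆ S) : ∃ L, Enumerates L 𝒮 := by
  classical
  have hfin : 𝒮.Finite := hS.finite_subsets.subset h𝒮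
  have h : ∀ s : Set α, ∃ C : List α, s ∈ 𝒮 → C.Nodup ∧ {q | q ∈ C} = s := by
    intro s
    by_cases hs : s ∈ 𝒮
    · have hsf := hS.subset (h𝒮 s hs)
      exact ⟨hsf.toFinset.toList, fun _ => ⟨Finset.nodup_toList _, by ext; simp⟩⟩
    · exact ⟨[], fun h => absurd h hs⟩
  choose c hc using h
  have hmem : ∀ {s}, s ∈ hfin.toFinset.toList ↔ s ∈ 𝒮 := by simp
  refine ⟨hfin.toFinset.toList.map c, ?_, ?_, ?_, ?_⟩
  · intro C hC
    obtain ⟨s, hs, rfl⟩ := List.mem_map.1 hC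
    exact (hc s (hmem.1 hs)).1
  · rw [List.pairwise_map]
    refine List.Pairwise.imp_of_mem (fun {s t} hs ht hst => ?_) (Finset.nodup_toList _)
    rwa [sameElems_iff, (hc s (hmem.1 hs)).2, (hc t (hmem.1 ht)).2]
  · intro C hC
    obtain ⟨s, hs, rfl⟩ := List.mem_map.1 hC
    rw [(hc s (hmem.1 hs)).2]
    exact hmem.1 hs
  · intro s hs
    exact ⟨c s, List.mem_map_of_mem (hmem.2 hs), (hc s hs).2⟩

theorem Overlap.refl (p : PairData d) : Overlap p p := ⟨rfl, by simp [zero_mem]⟩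

theorem Overlap.symm {p q : PairData d} (h : Overlap p q) : Overlap q p :=
  ⟨h.1.symm, by rw [← neg_sub, ← h.1]; exact neg_mem h.2⟩

theorem Overlap.trans {p q r : PairData d} (h : Overlap p q) (h' : Overlap q r) : Overlap p r := by
  refine ⟨h.1.trans h'.1, ?_⟩
  have := add_mem h.2 (h.1 ▸ h'.2 : q.1 - r.1 ∈ ZZ p.2)
  rwa [sub_add_sub_cancel] at this

/-- The classes of elements of `S` with respect to overlapping. -/
def classesOf (S : Set (PairData d)) : Set (Set (PairData d)) :=
  {C | ∃ p ∈ S, C = {q | q ∈ S ∧ Overlap p q}}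

/-- The classes of elements of `S` that are maximal with respect to divisibility. -/
def maximalClassesOf (A : Finset (Fin d → ℤ)) (S : Set (PairData d)) : Set (Set (PairData d)) :=
  {C | C ∈ classesOf S ∧ ∀ D ∈ classesOf S, ClassDivides A C D → D = C}

/-- A certificate that two pairs do not overlap. -/
def NotOverlapCert (p q : PairData d) : Prop := p.2 ≠ q.2 ∨ Separated p.2 (p.1 - q.1)

theorem notOverlapCert_iff {p q : PairData d} : NotOverlapCert p q ↔ ¬ Overlap p q := by
  rw [NotOverlapCert, separated_iff, Overlap, not_and_or]

/-- A certificate that `M` lists the overlap classes of the elements of `L`. -/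
def ListsClasses (L : List (PairData d)) (M : List (List (PairData d))) : Prop :=
  (∀ C ∈ M, C.Nodup) ∧ (M.Pairwise fun C D => ¬ SameElems C D) ∧
    (∀ C ∈ M, (∀ q ∈ C, q ∈ L) ∧ ∃ p ∈ C, ∀ q ∈ L,
      q ∈ C ∧ Overlap p q ∨ q ∉ C ∧ NotOverlapCert p q) ∧ ∀ p ∈ L, ∃ C ∈ M, p ∈ C

/-- Comparing all of `L` with one representative determines a class, because overlapping is an
equivalence relation. -/
theorem listsClasses_iff {L : List (PairData d)} {M : List (List (PairData d))} :
    ListsClasses L M ↔ Enumerates M (classesOf {p | p ∈ L}) := by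
  constructor
  · rintro ⟨h₁, h₂, h₃, h₄⟩
    have h₅ : ∀ C ∈ M, ∃ p ∈ C, p ∈ L ∧ {q | q ∈ C} = {q | q ∈ L ∧ Overlap p q} := by
      intro C hC
      obtain ⟨hCL, p, hp, h⟩ := h₃ C hC
      refine ⟨p, hp, hCL p hp, Set.ext fun q => ⟨fun hq => ⟨hCL q hq, ?_⟩, fun hq => ?_⟩⟩
      · exact ((h q (hCL q hq)).resolve_right fun h' => h'.1 hq).2
      · exact ((h q hq.1).resolve_right fun h' => notOverlapCert_iff.1 h'.2 hq.2).1
    refine ⟨h₁, h₂, fun C hC => ?_, ?_⟩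
    · obtain ⟨p, -, hpL, h⟩ := h₅ C hC
      exact ⟨p, hpL, h⟩
    · rintro s ⟨p, hp, rfl⟩
      obtain ⟨C, hC, hpC⟩ := h₄ p hp
      obtain ⟨p', -, -, h⟩ := h₅ C hC
      have hpp' : Overlap p' p := (h.le hpC : p ∈ L ∧ Overlap p' p).2
      refine ⟨C, hC, h.trans (Set.ext fun q => and_congr_right fun _ =>
        ⟨hpp'.symm.trans, hpp'.trans⟩)⟩
  · rintro ⟨h₁, h₂, h₃, h₄⟩
    refine ⟨h₁, h₂, fun C hC => ?_, fun p hp => ?_⟩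
    · obtain ⟨p, hp, h⟩ := h₃ C hC
      have hmem : ∀ q, q ∈ C ↔ q ∈ L ∧ Overlap p q := fun q => Set.ext_iff.1 h q
      refine ⟨fun q hq => ((hmem q).1 hq).1, p, (hmem p).2 ⟨hp, Overlap.refl p⟩, fun q hq => ?_⟩
      rw [notOverlapCert_iff, hmem]
      tauto
    · obtain ⟨C, hC, h⟩ := h₄ _ ⟨p, hp, rfl⟩
      exact ⟨C, hC, h.ge ⟨hp, Overlap.refl p⟩⟩

/-- A certificate that the class of `C` divides the class of `D`. -/
def DividesCert (A : Finset (Fin d → ℤ)) (C D : List (PairData d)) : Prop :=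
  ∃ p ∈ C, ∃ q ∈ D, p.2 ⊆ q.2 ∧ InLocalization A q.2 (q.1 - p.1)

/-- A certificate that the class of `C` does not divide the class of `D`. -/
def NotDividesCert (A : Finset (Fin d → ℤ)) (C D : List (PairData d)) : Prop :=
  ∀ p ∈ C, ∀ q ∈ D, ¬ p.2 ⊆ q.2 ∨ Avoids A q.2 (q.1 - p.1)

theorem dividesCert_iff {A : Finset (Fin d → ℤ)} {C D : List (PairData d)}
    (hC : ∀ p ∈ C, IsPair A p) (hD : ∀ p ∈ D, IsPair A p) :
    DividesCert A C D ↔ ClassDivides A {p | p ∈ C} {p | p ∈ D} := by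
  refine exists_congr fun p => and_congr_right fun hp => exists_congr fun q =>
    and_congr_right fun hq => ?_
  rw [divides_iff (hC p hp) (hD q hq)]

theorem notDividesCert_iff {A : Finset (Fin d → ℤ)} {C D : List (PairData d)}
    (hC : ∀ p ∈ C, IsPair A p) (hD : ∀ p ∈ D, IsPair A p) :
    NotDividesCert A C D ↔ ¬ ClassDivides A {p | p ∈ C} {p | p ∈ D} := by
  rw [← dividesCert_iff hC hD, DividesCert]
  push Not
  refine forall_congr' fun p => forall_congr' fun hp => forall_congr' fun q =>
    forall_congr' fun hq => ?_
  rw [(hD q hq).2.avoids_iff, imp_iff_not_or]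

/-- A certificate that `N` lists the maximal ones of the classes listed by `M`. -/
def ListsMaximal (A : Finset (Fin d → ℤ)) (M N : List (List (PairData d))) : Prop :=
  (∀ C ∈ N, C.Nodup) ∧ (N.Pairwise fun C D => ¬ SameElems C D) ∧
    (∀ C ∈ N, ∃ D ∈ M, SameElems C D ∧ ∀ D' ∈ M, SameElems D' C ∨ NotDividesCert A D D') ∧
    ∀ D ∈ M, (∃ C ∈ N, SameElems C D) ∨ ∃ D' ∈ M, ¬ SameElems D' D ∧ DividesCert A D D'

/-- Both directions of maximality are certified positively: a listed class comes with proofs of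
non-divisibility, an omitted one with another class that it divides. -/
theorem listsMaximal_iff {A : Finset (Fin d → ℤ)} {S : Set (PairData d)}
    (hS : ∀ p ∈ S, IsPair A p) {M N : List (List (PairData d))} (hM : Enumerates M (classesOf S)) :
    ListsMaximal A M N ↔ Enumerates N (maximalClassesOf A S) := by
  have hpair : ∀ C ∈ M, ∀ p ∈ C, IsPair A p := by
    intro C hC p hp
    obtain ⟨q, hq, h⟩ := hM.mem C hC
    exact hS p (h.le hp : p ∈ S ∧ Overlap q p).1
  constructor
  · rintro ⟨h₁, h₂, h₃, h₄⟩
    refine ⟨h₁, h₂, fun C hC => ?_, ?_⟩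
    · obtain ⟨D, hD, hCD, h⟩ := h₃ C hC
      rw [sameElems_iff] at hCD
      rw [hCD]
      refine ⟨hM.mem D hD, fun s hs hdiv => ?_⟩
      obtain ⟨D', hD', rfl⟩ := hM.exists_mem s hs
      rcases h D' hD' with h | h
      · rw [← hCD]; exact sameElems_iff.1 h
      · exact absurd hdiv ((notDividesCert_iff (hpair D hD) (hpair D' hD')).1 h)
    · rintro s ⟨hs, hmax⟩
      obtain ⟨D, hD, rfl⟩ := hM.exists_mem s hs
      rcases h₄ D hD with ⟨C, hC, h⟩ | ⟨D', hD', hne, hdiv⟩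
      · exact ⟨C, hC, sameElems_iff.1 h⟩
      · exact absurd (sameElems_iff.2 (hmax _ (hM.mem D' hD')
          ((dividesCert_iff (hpair D hD) (hpair D' hD')).1 hdiv))) hne
  · rintro ⟨h₁, h₂, h₃, h₄⟩
    refine ⟨h₁, h₂, fun C hC => ?_, fun D hD => ?_⟩
    · obtain ⟨hCS, hmax⟩ := h₃ C hC
      obtain ⟨D, hD, hDC⟩ := hM.exists_mem _ hCS
      refine ⟨D, hD, sameElems_iff.2 hDC.symm, fun D' hD' => ?_⟩
      rw [notDividesCert_iff (hpair D hD) (hpair D' hD'), sameElems_iff, hDC]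
      by_cases hdiv : ClassDivides A {q | q ∈ C} {q | q ∈ D'}
      · exact Or.inl (hmax _ (hM.mem D' hD') hdiv)
      · exact Or.inr hdiv
    · by_cases hmax : {q | q ∈ D} ∈ maximalClassesOf A S
      · obtain ⟨C, hC, h⟩ := h₄ _ hmax
        exact Or.inl ⟨C, hC, sameElems_iff.2 h⟩
      · right
        by_contra hcon
        push Not at hcon
        refine hmax ⟨hM.mem D hD, fun s hs hdiv => ?_⟩
        obtain ⟨D', hD', rfl⟩ := hM.exists_mem s hs
        by_contra hne
        exact hcon D' hD' (fun h => hne (sameElems_iff.1 h))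
          ((dividesCert_iff (hpair D hD) (hpair D' hD')).2 hdiv)

/-- A certificate that `L`, `M`, `N` list the standard pairs, their overlap classes, and the
overlap classes that are maximal with respect to divisibility. -/
def IsOutput (A B : Finset (Fin d → ℤ)) (L : List (PairData d))
    (M N : List (List (PairData d))) : Prop :=
  ListsStandard A B L ∧ L.Nodup ∧ ListsClasses L M ∧ ListsMaximal A M N

theorem isOutput_iff {A B : Finset (Fin d → ℤ)} (hA : IsConfiguration A) {L : List (PairData d)}
    {M N : List (List (PairData d))} :
    IsOutput A B L M N ↔ (∀ p, p ∈ L ↔ IsStandard A B p) ∧ L.Nodup ∧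
      Enumerates M (classesOf {p | IsStandard A B p}) ∧
      Enumerates N (maximalClassesOf A {p | IsStandard A B p}) := by
  rw [IsOutput, listsStandard_iff hA, listsClasses_iff]
  refine and_congr_right fun h => and_congr_right fun _ => ?_
  rw [show {p | p ∈ L} = {p | IsStandard A B p} from Set.ext h]
  exact and_congr_right fun hM => listsMaximal_iff
    (fun p (hp : IsStandard A B p) => ⟨inLocalization_empty.1 hp.mem, hp.isFace⟩) hM

theorem exists_isOutput {A : Finset (Fin d → ℤ)} (hA : IsConfiguration A)
    (B : Finset (Fin d → ℤ)) : ∃ L M N, IsOutput A B L M N := by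
  have hfin := finite_isStandard A B
  have hsub : ∀ s ∈ classesOf {p | IsStandard A B p}, s ⊆ {p | IsStandard A B p} := by
    rintro _ ⟨p, -, rfl⟩ q hq
    exact hq.1
  obtain ⟨M, hM⟩ := exists_enumerates hfin hsub
  obtain ⟨N, hN⟩ := exists_enumerates (𝒮 := maximalClassesOf A {p | IsStandard A B p}) hfin
    fun s hs => hsub s hs.1
  exact ⟨hfin.toFinset.toList, M, N, (isOutput_iff hA).2 ⟨by simp, Finset.nodup_toList _, hM, hN⟩⟩

end

/-! ### Denotations of codes -/

/-- The vector denoted by a list of integers, padded by zeros or truncated. -/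
def decVec (d : ℕ) (c : VecCode) : Fin d → ℤ := fun i => c.getD i 0

/-- The finite set of vectors denoted by a list of codes. -/
def decFinset (d : ℕ) (c : List VecCode) : Finset (Fin d → ℤ) := (c.map (decVec d)).toFinset

/-- The pair denoted by a code. -/
def decPair (d : ℕ) (c : PairCode) : PairData d := (decVec d c.1, decFinset d c.2)

theorem decVec_vecCode {d : ℕ} (v : Fin d → ℤ) : decVec d (vecCode v) = v := by
  ext i
  simp [decVec, vecCode]

/-- Decoding is total and onto, so quantifiers over vectors of varying dimension become quantifiers
over one fixed type of codes. -/
theorem decVec_surjective (d : ℕ) : Function.Surjective (decVec d) :=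
  fun v => ⟨vecCode v, decVec_vecCode v⟩

theorem decFinset_surjective (d : ℕ) : Function.Surjective (decFinset d) := fun F => by
  obtain ⟨l, hl⟩ := (decVec_surjective d).list_map F.toList
  exact ⟨l, by rw [decFinset, hl, Finset.toList_toFinset]⟩

theorem decPair_surjective (d : ℕ) : Function.Surjective (decPair d) := fun p => by
  obtain ⟨c, hc⟩ := decVec_surjective d p.1
  obtain ⟨l, hl⟩ := decFinset_surjective d p.2
  exact ⟨(c, l), Prod.ext hc hl⟩

theorem mem_decFinset {d : ℕ} {c : List VecCode} {v : Fin d → ℤ} :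
    v ∈ decFinset d c ↔ v ∈ c.map (decVec d) := List.mem_toFinset

section

variable {α β : Type*} [Primcodable α] [Primcodable β] {d : α → ℕ}

/-- A family of vectors with a primitive recursive family of codes. -/
def PrimrecVec (d : α → ℕ) (v : ∀ x, Fin (d x) → ℤ) : Prop :=
  ∃ c : α → VecCode, Primrec c ∧ ∀ x, v x = decVec (d x) (c x)

/-- A family of finite sets of vectors with a primitive recursive family of codes. -/
def PrimrecFin (d : α → ℕ) (F : ∀ x, Finset (Fin (d x) → ℤ)) : Prop :=
  ∃ c : α → List VecCode, Primrec c ∧ ∀ x, F x = decFinset (d x) (c x)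

/-- A family of pairs with a primitive recursive family of codes. -/
def PrimrecPair (d : α → ℕ) (p : ∀ x, PairData (d x)) : Prop :=
  PrimrecVec d (fun x => (p x).1) ∧ PrimrecFin d (fun x => (p x).2)

theorem PrimrecVec.dec {c : α → VecCode} (hc : Primrec c) :
    PrimrecVec d fun x => decVec (d x) (c x) := ⟨c, hc, fun _ => rfl⟩

theorem PrimrecFin.dec {c : α → List VecCode} (hc : Primrec c) :
    PrimrecFin d fun x => decFinset (d x) (c x) := ⟨c, hc, fun _ => rfl⟩

theorem PrimrecPair.dec {c : α → PairCode} (hc : Primrec c) :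
    PrimrecPair d fun x => decPair (d x) (c x) :=
  ⟨PrimrecVec.dec (c := fun x => (c x).1) (by fun_prop),
    PrimrecFin.dec (c := fun x => (c x).2) (by fun_prop)⟩

theorem PrimrecVec.comp {v : ∀ x, Fin (d x) → ℤ} (hv : PrimrecVec d v) {g : β → α}
    (hg : Primrec g) : PrimrecVec (fun z => d (g z)) fun z => v (g z) := by
  obtain ⟨c, hc, h⟩ := hv
  exact ⟨fun z => c (g z), hc.comp hg, fun z => h (g z)⟩

theorem PrimrecFin.comp {F : ∀ x, Finset (Fin (d x) → ℤ)} (hF : PrimrecFin d F) {g : β → α}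
    (hg : Primrec g) : PrimrecFin (fun z => d (g z)) fun z => F (g z) := by
  obtain ⟨c, hc, h⟩ := hF
  exact ⟨fun z => c (g z), hc.comp hg, fun z => h (g z)⟩

theorem PrimrecPair.comp {p : ∀ x, PairData (d x)} (hp : PrimrecPair d p) {g : β → α}
    (hg : Primrec g) : PrimrecPair (fun z => d (g z)) fun z => p (g z) :=
  ⟨hp.1.comp hg, hp.2.comp hg⟩

theorem primrec_getD {l : α → VecCode} {i : α → ℕ} (hl : Primrec l) (hi : Primrec i) :
    Primrec fun x => (l x).getD (i x) 0 :=
  (Primrec.list_getD 0).comp hl hi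

attribute [fun_prop] primrec_getD

theorem PrimrecVec.ofFn (hd : Primrec d) {h : α → ℕ → ℤ}
    (hh : Primrec fun z : α × ℕ => h z.1 z.2) : PrimrecVec d fun x i => h x i :=
  ⟨fun x => (List.range (d x)).map (h x), Primrec.list_map (Primrec.list_range.comp hd) hh,
    fun x => by ext i; simp [decVec]⟩

theorem PrimrecVec.zero : PrimrecVec d fun _ => 0 :=
  ⟨fun _ => [], Primrec.const _, fun x => by ext i; simp [decVec]⟩

variable {v w : ∀ x, Fin (d x) → ℤ}

theorem PrimrecVec.sub (hd : Primrec d) (hv : PrimrecVec d v) (hw : PrimrecVec d w) :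
    PrimrecVec d fun x => v x - w x := by
  obtain ⟨c, hc, h⟩ := hv
  obtain ⟨c', hc', h'⟩ := hw
  have := PrimrecVec.ofFn hd (h := fun x i => (c x).getD i 0 - (c' x).getD i 0) (by fun_prop)
  simp only [h, h']
  exact this

theorem PrimrecVec.add (hd : Primrec d) (hv : PrimrecVec d v) (hw : PrimrecVec d w) :
    PrimrecVec d fun x => v x + w x := by
  obtain ⟨c, hc, h⟩ := hv
  obtain ⟨c', hc', h'⟩ := hw
  have := PrimrecVec.ofFn hd (h := fun x i => (c x).getD i 0 + (c' x).getD i 0) (by fun_prop)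
  simp only [h, h']
  exact this

theorem PrimrecVec.sum (hd : Primrec d) {L : α → List VecCode} (hL : Primrec L) :
    PrimrecVec d fun x => ((L x).map (decVec (d x))).sum := by
  have h1 : Primrec fun z : α × ℕ => ((L z.1).map fun c => c.getD z.2 0).sum :=
    primrec_int_sum (L := fun z : α × ℕ => L z.1) (h := fun z c => c.getD z.2 0)
      (by fun_prop) (by fun_prop)
  have := PrimrecVec.ofFn hd (h := fun x i => ((L x).map fun c => c.getD i 0).sum) h1
  convert this using 3 with x i
  generalize L x = l
  induction l with
  | nil => rfl
  | cons c l ih => rw [List.map_cons, List.map_cons, List.sum_cons, List.sum_cons, ← ih]; rfl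

theorem PrimrecVec.dotProduct (hd : Primrec d) (hv : PrimrecVec d v) (hw : PrimrecVec d w) :
    Primrec fun x => v x ⬝ᵥ w x := by
  obtain ⟨c, hc, h⟩ := hv
  obtain ⟨c', hc', h'⟩ := hw
  have h1 : Primrec fun x =>
      ((List.range (d x)).map fun i => (c x).getD i 0 * (c' x).getD i 0).sum :=
    primrec_int_sum (Primrec.list_range.comp hd)
      (h := fun x i => (c x).getD i 0 * (c' x).getD i 0) (by fun_prop)
  refine h1.of_eq fun x => ?_
  rw [h, h', _root_.dotProduct]
  simp only [decVec]
  rw [Fin.sum_univ_eq_sum_range fun i => (c x).getD i 0 * (c' x).getD i 0]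
  generalize d x = n
  induction n with
  | zero => rfl
  | succ n ih => rw [List.range_succ, Finset.sum_range_succ, ← ih, List.map_append, List.sum_append]; simp

theorem PrimrecVec.eq (hd : Primrec d) (hv : PrimrecVec d v) (hw : PrimrecVec d w) :
    PrimrecPred fun x => v x = w x := by
  obtain ⟨c, hc, h⟩ := hv
  obtain ⟨c', hc', h'⟩ := hw
  have h1 : PrimrecPred fun x => ∀ i < d x, (c x).getD i 0 = (c' x).getD i 0 :=
    primrecPred_forall_lt (p := fun z : α × ℕ => (c z.1).getD z.2 0 = (c' z.1).getD z.2 0)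
      (Primrec.eq.comp (by fun_prop) (by fun_prop)) hd
  refine h1.of_eq fun x => ?_
  rw [h, h', funext_iff, Fin.forall_iff]
  rfl

variable {F G : ∀ x, Finset (Fin (d x) → ℤ)}

theorem PrimrecFin.empty : PrimrecFin d fun _ => ∅ :=
  ⟨fun _ => [], Primrec.const _, fun _ => rfl⟩

theorem PrimrecFin.insert (hv : PrimrecVec d v) (hF : PrimrecFin d F) :
    PrimrecFin d fun x => insert (v x) (F x) := by
  obtain ⟨c, hc, h⟩ := hv
  obtain ⟨l, hl, h'⟩ := hF
  refine ⟨fun x => c x :: l x, Primrec.list_cons.comp hc hl, fun x => ?_⟩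
  simp only [h, h']
  rw [decFinset, decFinset, List.map_cons, List.toFinset_cons]

theorem PrimrecFin.mem (hd : Primrec d) (hF : PrimrecFin d F) (hv : PrimrecVec d v) :
    PrimrecPred fun x => v x ∈ F x := by
  obtain ⟨l, hl, h⟩ := hF
  have h1 : PrimrecPred fun x => ∃ c ∈ l x, decVec (d x) c = v x :=
    primrecPred_exists_mem (p := fun z : α × VecCode => decVec (d z.1) z.2 = v z.1)
      (PrimrecVec.eq (d := fun z : α × VecCode => d z.1) (by fun_prop)
        (.dec (by fun_prop)) (hv.comp Primrec.fst)) hl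
  exact h1.of_eq fun x => by rw [h, mem_decFinset, List.mem_map]

theorem PrimrecFin.subset (hd : Primrec d) (hF : PrimrecFin d F) (hG : PrimrecFin d G) :
    PrimrecPred fun x => F x ⊆ G x := by
  obtain ⟨l, hl, h⟩ := hF
  have h1 : PrimrecPred fun x => ∀ c ∈ l x, decVec (d x) c ∈ G x :=
    primrecPred_forall_mem (p := fun z : α × VecCode => decVec (d z.1) z.2 ∈ G z.1)
      (PrimrecFin.mem (d := fun z : α × VecCode => d z.1) (by fun_prop)
        (hG.comp Primrec.fst) (.dec (by fun_prop))) hl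
  exact h1.of_eq fun x => by simp [h, Finset.subset_iff, mem_decFinset]

theorem PrimrecFin.ssubset (hd : Primrec d) (hF : PrimrecFin d F) (hG : PrimrecFin d G) :
    PrimrecPred fun x => F x ⊂ G x :=
  (hF.subset hd hG).and (hG.subset hd hF).not

theorem PrimrecFin.eq (hd : Primrec d) (hF : PrimrecFin d F) (hG : PrimrecFin d G) :
    PrimrecPred fun x => F x = G x :=
  ((hF.subset hd hG).and (hG.subset hd hF)).of_eq fun _ => Finset.Subset.antisymm_iff.symm

theorem PrimrecFin.forall_mem (hF : PrimrecFin d F) {p : ∀ x, (Fin (d x) → ℤ) → Prop}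
    (hp : Sigma1 fun z : α × VecCode => p z.1 (decVec (d z.1) z.2)) :
    Sigma1 fun x => ∀ v ∈ F x, p x v := by
  obtain ⟨l, hl, h⟩ := hF
  refine (Sigma1.forall_mem_map (fun x => decVec (d x)) hl hp).congr fun x => ?_
  simp only [h, mem_decFinset]

theorem PrimrecFin.exists_mem (hF : PrimrecFin d F) {p : ∀ x, (Fin (d x) → ℤ) → Prop}
    (hp : Sigma1 fun z : α × VecCode => p z.1 (decVec (d z.1) z.2)) :
    Sigma1 fun x => ∃ v ∈ F x, p x v := by
  obtain ⟨l, hl, h⟩ := hF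
  refine (Sigma1.exists_mem_map (fun x => decVec (d x)) hl hp).congr fun x => ?_
  simp only [h, mem_decFinset]

theorem PrimrecPair.eq (hd : Primrec d) {p q : ∀ x, PairData (d x)} (hp : PrimrecPair d p)
    (hq : PrimrecPair d q) : PrimrecPred fun x => p x = q x :=
  ((hp.1.eq hd hq.1).and (hp.2.eq hd hq.2)).of_eq fun _ => Prod.ext_iff.symm

theorem PrimrecPair.mem (hd : Primrec d) {p : ∀ x, PairData (d x)} (hp : PrimrecPair d p)
    {L : α → List PairCode} (hL : Primrec L) :
    PrimrecPred fun x => p x ∈ (L x).map (decPair (d x)) := by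
  have h1 : PrimrecPred fun x => ∃ c ∈ L x, decPair (d x) c = p x :=
    primrecPred_exists_mem (p := fun z : α × PairCode => decPair (d z.1) z.2 = p z.1)
      (PrimrecPair.eq (d := fun z : α × PairCode => d z.1) (by fun_prop)
        (.dec (by fun_prop)) (hp.comp Primrec.fst)) hL
  exact h1.of_eq fun x => by rw [List.mem_map]

theorem PrimrecFin.mem_list (hd : Primrec d) (hF : PrimrecFin d F)
    {L : α → List (List VecCode)} (hL : Primrec L) :
    PrimrecPred fun x => F x ∈ (L x).map (decFinset (d x)) := by
  have h1 : PrimrecPred fun x => ∃ c ∈ L x, decFinset (d x) c = F x :=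
    primrecPred_exists_mem (p := fun z : α × List VecCode => decFinset (d z.1) z.2 = F z.1)
      (PrimrecFin.eq (d := fun z : α × List VecCode => d z.1) (by fun_prop)
        (.dec (by fun_prop)) (hF.comp Primrec.fst)) hL
  exact h1.of_eq fun x => by rw [List.mem_map]

theorem primrecPred_sameElems (hd : Primrec d) {C D : α → List PairCode} (hC : Primrec C)
    (hD : Primrec D) :
    PrimrecPred fun x => SameElems ((C x).map (decPair (d x))) ((D x).map (decPair (d x))) := by
  have key : ∀ {C D : α → List PairCode}, Primrec C → Primrec D →
      PrimrecPred fun x => ∀ c ∈ C x, decPair (d x) c ∈ (D x).map (decPair (d x)) :=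
    fun {C D} hC hD => primrecPred_forall_mem
      (p := fun z : α × PairCode => decPair (d z.1) z.2 ∈ (D z.1).map (decPair (d z.1)))
      (PrimrecPair.mem (d := fun z : α × PairCode => d z.1) (by fun_prop)
        (.dec (by fun_prop)) (by fun_prop)) hC
  exact ((key hC hD).and (key hD hC)).of_eq fun x => by
    simp only [SameElems, List.forall_mem_map]

/-! ### The certificates are recursively enumerable -/

/-- The witnesses are a list in `A` and a list in `F`, whose sums are compared. -/
theorem sigma1_inLocalization (hd : Primrec d) {A : ∀ x, Finset (Fin (d x) → ℤ)}
    (hA : PrimrecFin d A) (hF : PrimrecFin d F) (hv : PrimrecVec d v) :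
    Sigma1 fun x => InLocalization (A x) (F x) (v x) := by
  have h1 : Sigma1 fun x => ∃ l : List (Fin (d x) → ℤ), (∀ u ∈ l, u ∈ A x) ∧
      ∃ m : List (Fin (d x) → ℤ), (∀ u ∈ m, u ∈ F x) ∧ v x + m.sum = l.sum := by
    refine Sigma1.exists_surj (fun x => List.map (decVec (d x)))
      (fun x => (decVec_surjective _).list_map) (.and ?_ ?_)
    · refine Sigma1.forall_mem_map (fun z => decVec (d z.1)) Primrec.snd (.of_primrec ?_)
      exact (hA.comp (Primrec.fst.comp Primrec.fst)).mem (by fun_prop) (.dec (by fun_prop))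
    · refine Sigma1.exists_surj (fun z : α × List VecCode => List.map (decVec (d z.1)))
        (fun z => (decVec_surjective _).list_map) (.and ?_ (.of_primrec ?_))
      · refine Sigma1.forall_mem_map
          (fun z : (α × List VecCode) × List VecCode => decVec (d z.1.1)) Primrec.snd (.of_primrec ?_)
        exact (hF.comp (Primrec.fst.comp (Primrec.fst.comp Primrec.fst))).mem (by fun_prop)
          (.dec (by fun_prop))
      · exact PrimrecVec.eq (by fun_prop) (.add (by fun_prop)
          (hv.comp (Primrec.fst.comp Primrec.fst)) (.sum (by fun_prop) (by fun_prop)))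
          (.sum (by fun_prop) (by fun_prop))
  refine h1.congr fun x => ?_
  constructor
  · rintro ⟨u, hu, u', hu', h⟩
    obtain ⟨l, hl, rfl⟩ := mem_NN_iff.1 hu
    obtain ⟨m, hm, rfl⟩ := mem_NN_iff.1 hu'
    exact ⟨l, hl, m, hm, h⟩
  · rintro ⟨l, hl, m, hm, h⟩
    exact ⟨_, mem_NN_iff.2 ⟨l, hl, rfl⟩, _, mem_NN_iff.2 ⟨m, hm, rfl⟩, h⟩

theorem sigma1_separated (hd : Primrec d) (hF : PrimrecFin d F) (hv : PrimrecVec d v) :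
    Sigma1 fun x => Separated (F x) (v x) := by
  refine Sigma1.exists_surj (fun x => decVec (d x)) (fun x => decVec_surjective _) ?_
  refine Sigma1.exists_code (Sigma1.exists_code (Sigma1.exists_code (.and ?_
    (.of_primrec (.and ?_ (.and ?_ ?_))))))
  · refine (hF.comp (Primrec.fst.comp (Primrec.fst.comp
      (Primrec.fst.comp Primrec.fst)))).forall_mem (Sigma1.exists_code (.of_primrec ?_))
    exact Primrec.eq.comp
      (PrimrecVec.dotProduct (by fun_prop) (.dec (by fun_prop)) (.dec (by fun_prop)))
      (by fun_prop)
  · exact Primrec.eq.comp (PrimrecVec.dotProduct (by fun_prop) (.dec (by fun_prop))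
      (hv.comp (Primrec.fst.comp (Primrec.fst.comp (Primrec.fst.comp Primrec.fst)))))
      (by fun_prop)
  · exact primrecPred_int_lt (by fun_prop) (by fun_prop)
  · exact primrecPred_int_lt (by fun_prop) (by fun_prop)

theorem PrimrecVec.mem_list (hd : Primrec d) (hv : PrimrecVec d v) {S : α → List VecCode}
    (hS : Primrec S) : PrimrecPred fun x => v x ∈ (S x).map (decVec (d x)) :=
  ((PrimrecFin.dec hS).mem hd hv).of_eq fun _ => mem_decFinset

theorem sigma1_avoids (hd : Primrec d) {A : ∀ x, Finset (Fin (d x) → ℤ)}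
    (hA : PrimrecFin d A) (hF : PrimrecFin d F) (hv : PrimrecVec d v) :
    Sigma1 fun x => Avoids (A x) (F x) (v x) := by
  refine Sigma1.exists_surj (fun x => decVec (d x)) (fun x => decVec_surjective _) ?_
  refine Sigma1.exists_surj (fun x : α × VecCode => List.map (decVec (d x.1)))
    (fun x => (decVec_surjective _).list_map) (.and ?_ (.and ?_ (.and ?_ ?_)))
  · refine (hF.comp (Primrec.fst.comp Primrec.fst)).forall_mem (.of_primrec ?_)
    exact Primrec.eq.comp
      (PrimrecVec.dotProduct (by fun_prop) (.dec (by fun_prop)) (.dec (by fun_prop)))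
      (by fun_prop)
  · refine (hA.comp (Primrec.fst.comp Primrec.fst)).forall_mem (.of_primrec ?_)
    exact primrecPred_int_le (by fun_prop)
      (PrimrecVec.dotProduct (by fun_prop) (.dec (by fun_prop)) (.dec (by fun_prop)))
  · exact .of_primrec <| PrimrecVec.mem_list (by fun_prop) (hv.comp (Primrec.fst.comp Primrec.fst)) (by fun_prop)
  · refine Sigma1.forall_mem_map
      (fun z : (α × VecCode) × List VecCode => decVec (d z.1.1)) Primrec.snd (.and ?_ ?_)
    · exact sigma1_separated (by fun_prop)
        (hF.comp (Primrec.fst.comp (Primrec.fst.comp Primrec.fst))) (.dec (by fun_prop))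
    · refine (hA.comp (Primrec.fst.comp (Primrec.fst.comp Primrec.fst))).forall_mem
        (.or (.of_primrec ?_) (.or (.of_primrec ?_) ?_))
      · exact (hF.comp (Primrec.fst.comp (Primrec.fst.comp
          (Primrec.fst.comp Primrec.fst)))).mem (by fun_prop) (.dec (by fun_prop))
      · exact primrecPred_int_lt (PrimrecVec.dotProduct (by fun_prop) (.dec (by fun_prop))
          (.sub (by fun_prop) (.dec (by fun_prop)) (.dec (by fun_prop)))) (by fun_prop)
      · exact .of_primrec <| PrimrecVec.mem_list (by fun_prop)
          (.sub (by fun_prop) (.dec (by fun_prop)) (.dec (by fun_prop))) (by fun_prop)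

/-- The definition speaks of real cones; the search is for an integral exposing functional instead.
-/
theorem sigma1_isFace (hd : Primrec d) {A : ∀ x, Finset (Fin (d x) → ℤ)}
    (hA : PrimrecFin d A) (hF : PrimrecFin d F) : Sigma1 fun x => IsFace (A x) (F x) := by
  have h1 : Sigma1 fun x => F x ⊆ A x ∧ ∃ w, Exposes (A x) (F x) w := by
    refine .and (.of_primrec (hF.subset hd hA)) ?_
    refine Sigma1.exists_surj (fun x => decVec (d x)) (fun x => decVec_surjective _) (.and ?_ ?_)
    · refine (hF.comp Primrec.fst).forall_mem (.of_primrec ?_)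
      exact Primrec.eq.comp
        (PrimrecVec.dotProduct (by fun_prop) (.dec (by fun_prop)) (.dec (by fun_prop)))
        (by fun_prop)
    · refine (hA.comp Primrec.fst).forall_mem (.of_primrec (.or ?_ ?_))
      · exact (hF.comp (Primrec.fst.comp Primrec.fst)).mem (by fun_prop) (.dec (by fun_prop))
      · exact primrecPred_int_lt (by fun_prop)
          (PrimrecVec.dotProduct (by fun_prop) (.dec (by fun_prop)) (.dec (by fun_prop)))
  exact h1.congr fun x => ⟨fun h => ⟨h.subset, h.exists_exposes⟩,
    fun ⟨h, w, hw⟩ => hw.isFace h⟩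

end

section

variable {α : Type*} [Primcodable α] {d : α → ℕ} {A B F : ∀ x, Finset (Fin (d x) → ℤ)}

theorem sigma1_listsFaces (hd : Primrec d) (hA : PrimrecFin d A) {Φ : α → List (List VecCode)}
    (hΦ : Primrec Φ) : Sigma1 fun x => ListsFaces (A x) ((Φ x).map (decFinset (d x))) := by
  refine .and ?_ ?_
  · refine Sigma1.forall_mem_map (fun x => decFinset (d x)) hΦ ?_
    exact sigma1_isFace (by fun_prop) (hA.comp (by fun_prop)) (.dec (by fun_prop))
  · refine Sigma1.exists_surj (fun x => List.map (decFinset (d x)))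
      (fun x => (decFinset_surjective _).list_map) (.and (.of_primrec ?_) ?_)
    · exact PrimrecFin.mem_list (by fun_prop) .empty (by fun_prop)
    · refine Sigma1.forall_mem_map (fun z : α × List (List VecCode) => decFinset (d z.1))
        Primrec.snd (.and ?_ (.or (.of_primrec ?_) ?_))
      · refine PrimrecFin.forall_mem (hA.comp (by fun_prop)) (.of_primrec ?_)
        exact PrimrecFin.mem_list (by fun_prop) (.insert (.dec (by fun_prop)) (.dec (by fun_prop)))
          (by fun_prop)
      · exact PrimrecFin.mem_list (by fun_prop) (.dec (by fun_prop)) (by fun_prop)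
      · refine PrimrecFin.exists_mem (hA.comp (by fun_prop)) (.and (.of_primrec (.not ?_)) ?_)
        · exact PrimrecFin.mem (by fun_prop) (.dec (by fun_prop)) (.dec (by fun_prop))
        · exact sigma1_inLocalization (by fun_prop) (hA.comp (by fun_prop)) (.dec (by fun_prop))
            (.sub (by fun_prop) .zero (.dec (by fun_prop)))

theorem sigma1_standardCert (hd : Primrec d) (hA : PrimrecFin d A) (hB : PrimrecFin d B)
    {Φ : α → List (List VecCode)} (hΦ : Primrec Φ) {p : ∀ x, PairData (d x)}
    (hp : PrimrecPair d p) :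
    Sigma1 fun x => StandardCert (A x) (B x) ((Φ x).map (decFinset (d x))) (p x) := by
  refine .and (.of_primrec (hp.2.mem_list hd hΦ))
    (.and (sigma1_inLocalization hd hA .empty hp.1) (.and ?_ (.and ?_ ?_)))
  · refine PrimrecFin.forall_mem hB ?_
    exact sigma1_avoids (by fun_prop) (hA.comp (by fun_prop)) (hp.2.comp (by fun_prop))
      (.sub (by fun_prop) (hp.1.comp (by fun_prop)) (.dec (by fun_prop)))
  · refine PrimrecFin.forall_mem hp.2 ?_
    exact sigma1_avoids (by fun_prop) (hA.comp (by fun_prop)) .empty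
      (.sub (by fun_prop) (hp.1.comp (by fun_prop)) (.dec (by fun_prop)))
  · refine Sigma1.forall_mem_map (fun x => decFinset (d x)) hΦ
      (.or (.of_primrec (.not ?_)) ?_)
    · exact PrimrecFin.ssubset (by fun_prop) (hp.2.comp (by fun_prop)) (.dec (by fun_prop))
    · refine PrimrecFin.exists_mem (hB.comp (by fun_prop)) ?_
      exact sigma1_inLocalization (by fun_prop) (hA.comp (by fun_prop)) (.dec (by fun_prop))
        (.sub (by fun_prop) (hp.1.comp (by fun_prop)) (.dec (by fun_prop)))

theorem sigma1_leafCert (hd : Primrec d) (hA : PrimrecFin d A) (hB : PrimrecFin d B)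
    {Φ : α → List (List VecCode)} (hΦ : Primrec Φ) {L : α → List PairCode} (hL : Primrec L)
    (hF : PrimrecFin d F) {v : ∀ x, Fin (d x) → ℤ} (hv : PrimrecVec d v)
    {T : ∀ x, Finset (Fin (d x) → ℤ)} (hT : PrimrecFin d T) :
    Sigma1 fun x => LeafCert (A x) (B x) ((Φ x).map (decFinset (d x)))
      ((L x).map (decPair (d x))) (F x) (v x) (T x) := by
  refine .or ?_ (.or ?_ (.or ?_ ?_))
  · refine PrimrecFin.exists_mem hB ?_
    exact sigma1_inLocalization (by fun_prop) (hA.comp (by fun_prop)) (hF.comp (by fun_prop))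
      (.sub (by fun_prop) (hv.comp (by fun_prop)) (.dec (by fun_prop)))
  · refine PrimrecFin.exists_mem hF ?_
    exact sigma1_inLocalization (by fun_prop) (hA.comp (by fun_prop)) .empty
      (.sub (by fun_prop) (hv.comp (by fun_prop)) (.dec (by fun_prop)))
  · refine Sigma1.exists_mem_map (fun x => decFinset (d x)) hΦ
      (.and (.of_primrec ?_) (.and (.of_primrec ?_) ?_))
    · exact PrimrecFin.ssubset (by fun_prop) (hF.comp (by fun_prop)) (.dec (by fun_prop))
    · exact PrimrecFin.subset (by fun_prop) (hT.comp (by fun_prop)) (.dec (by fun_prop))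
    · refine PrimrecFin.forall_mem (hB.comp (by fun_prop)) ?_
      exact sigma1_avoids (by fun_prop) (hA.comp (by fun_prop)) (.dec (by fun_prop))
        (.sub (by fun_prop) (hv.comp (by fun_prop)) (.dec (by fun_prop)))
  · exact .of_primrec ((hT.eq hd .empty).and (PrimrecPair.mem hd ⟨hv, hF⟩ hL))

theorem sigma1_isTree (hd : Primrec d) 
    {leaf : ∀ x, (Fin (d x) → ℤ) → Finset (Fin (d x) → ℤ) → Prop}
    (hleaf : Sigma1 fun z : α × PairCode =>
      leaf z.1 (decPair (d z.1) z.2).1 (decPair (d z.1) z.2).2)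
    {E : α → List PairCode} (hE : Primrec E) :
    Sigma1 fun x => IsTree (leaf x) ((E x).map (decPair (d x))) := by
  refine Sigma1.forall_mem_map (fun x => decPair (d x)) hE (.or hleaf ?_)
  refine PrimrecFin.exists_mem (PrimrecPair.dec (by fun_prop)).2 ?_
  refine Sigma1.exists_mem_map (fun z : (α × PairCode) × VecCode => decPair (d z.1.1))
    (hE.comp (by fun_prop)) ?_
  refine Sigma1.exists_mem_map
    (fun z : ((α × PairCode) × VecCode) × PairCode => decPair (d z.1.1.1))
    (hE.comp (by fun_prop)) ?_
  refine .and (.of_primrec ?_) (.and (.of_primrec ?_) (.and (.of_primrec ?_)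
    (.and ?_ (.of_primrec ?_))))
  · exact PrimrecVec.eq (by fun_prop) (PrimrecPair.dec (by fun_prop)).1
      (.add (by fun_prop) (PrimrecPair.dec (by fun_prop)).1 (.dec (by fun_prop)))
  · exact PrimrecFin.eq (by fun_prop) (PrimrecPair.dec (by fun_prop)).2
      (PrimrecPair.dec (by fun_prop)).2
  · exact PrimrecVec.eq (by fun_prop) (PrimrecPair.dec (by fun_prop)).1
      (PrimrecPair.dec (by fun_prop)).1
  · refine PrimrecFin.forall_mem (PrimrecPair.dec (by fun_prop)).2 (.of_primrec (.or ?_ ?_))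
    · exact PrimrecVec.eq (by fun_prop) (.dec (by fun_prop)) (.dec (by fun_prop))
    · exact PrimrecFin.mem (by fun_prop) (PrimrecPair.dec (by fun_prop)).2 (.dec (by fun_prop))
  · exact PrimrecFin.ssubset (by fun_prop) (PrimrecPair.dec (by fun_prop)).2
      (PrimrecPair.dec (by fun_prop)).2

theorem sigma1_listsStandard (hd : Primrec d) (hA : PrimrecFin d A) (hB : PrimrecFin d B)
    {L : α → List PairCode} (hL : Primrec L) :
    Sigma1 fun x => ListsStandard (A x) (B x) ((L x).map (decPair (d x))) := by
  refine Sigma1.exists_surj (fun x => List.map (decFinset (d x)))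
    (fun x => (decFinset_surjective _).list_map) (.and ?_ (.and ?_ ?_))
  · exact sigma1_listsFaces (by fun_prop) (hA.comp (by fun_prop)) (by fun_prop)
  · refine Sigma1.forall_mem_map (fun z : α × List (List VecCode) => decPair (d z.1))
      (hL.comp (by fun_prop)) ?_
    exact sigma1_standardCert (by fun_prop) (hA.comp (by fun_prop)) (hB.comp (by fun_prop))
      (by fun_prop) (.dec (by fun_prop))
  · refine Sigma1.forall_mem_map (fun z : α × List (List VecCode) => decFinset (d z.1))
      (by fun_prop) ?_
    refine Sigma1.exists_surj
      (fun z : (α × List (List VecCode)) × List VecCode => List.map (decPair (d z.1.1)))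
      (fun z => (decPair_surjective _).list_map) (.and (.of_primrec ?_) ?_)
    · exact PrimrecPair.mem (by fun_prop) ⟨.zero, hA.comp (by fun_prop)⟩ (by fun_prop)
    · refine sigma1_isTree (by fun_prop) ?_ (by fun_prop)
      exact sigma1_leafCert (by fun_prop) (hA.comp (by fun_prop)) (hB.comp (by fun_prop))
        (by fun_prop) (hL.comp (by fun_prop)) (.dec (by fun_prop))
        (PrimrecPair.dec (by fun_prop)).1 (PrimrecPair.dec (by fun_prop)).2

theorem sigma1_nodup (hd : Primrec d) {L : α → List PairCode} (hL : Primrec L) :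
    Sigma1 fun x => ((L x).map (decPair (d x))).Nodup := by
  have h : Sigma1 fun x => (L x).Pairwise fun c c' => decPair (d x) c ≠ decPair (d x) c' := by
    refine Sigma1.pairwise hL (.of_primrec (.not ?_))
    exact PrimrecPair.eq (by fun_prop) (.dec (by fun_prop)) (.dec (by fun_prop))
  exact h.congr fun x => List.pairwise_map

theorem sigma1_pairwise_not_sameElems (hd : Primrec d) {M : α → List (List PairCode)}
    (hM : Primrec M) :
    Sigma1 fun x => ((M x).map (List.map (decPair (d x)))).Pairwise
      fun C D => ¬ SameElems C D := by
  have h : Sigma1 fun x => (M x).Pairwise fun C D =>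
      ¬ SameElems (C.map (decPair (d x))) (D.map (decPair (d x))) := by
    refine Sigma1.pairwise hM (.of_primrec (.not ?_))
    exact primrecPred_sameElems (by fun_prop) (by fun_prop) (by fun_prop)
  exact h.congr fun x => List.pairwise_map

/-- `ℤF = ℕF - ℕF`, so overlapping is the localization test with `A` replaced by `F`. -/
theorem sigma1_overlap (hd : Primrec d) {p q : ∀ x, PairData (d x)} (hp : PrimrecPair d p)
    (hq : PrimrecPair d q) : Sigma1 fun x => Overlap (p x) (q x) := by
  have h : Sigma1 fun x => (p x).2 = (q x).2 ∧
      InLocalization (p x).2 (p x).2 ((p x).1 - (q x).1) :=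
    .and (.of_primrec (hp.2.eq hd hq.2))
      (sigma1_inLocalization hd hp.2 hp.2 (hp.1.sub hd hq.1))
  exact h.congr fun x => and_congr_right fun _ => mem_ZZ_iff

theorem sigma1_listsClasses (hd : Primrec d) {L : α → List PairCode} (hL : Primrec L)
    {M : α → List (List PairCode)} (hM : Primrec M) :
    Sigma1 fun x => ListsClasses ((L x).map (decPair (d x)))
      ((M x).map (List.map (decPair (d x)))) := by
  refine .and ?_ (.and (sigma1_pairwise_not_sameElems hd hM) (.and ?_ ?_))
  · refine Sigma1.forall_mem_map (fun x => List.map (decPair (d x))) hM ?_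
    exact sigma1_nodup (by fun_prop) (by fun_prop)
  · refine Sigma1.forall_mem_map (fun x => List.map (decPair (d x))) hM (.and ?_ ?_)
    · refine Sigma1.forall_mem_map (fun z : α × List PairCode => decPair (d z.1))
        (by fun_prop) (.of_primrec ?_)
      exact PrimrecPair.mem (by fun_prop) (.dec (by fun_prop)) (by fun_prop)
    · refine Sigma1.exists_mem_map (fun z : α × List PairCode => decPair (d z.1))
        (by fun_prop) ?_
      refine Sigma1.forall_mem_map (fun z : (α × List PairCode) × PairCode => decPair (d z.1.1))
        (by fun_prop) (.or (.and (.of_primrec ?_) ?_) (.and (.of_primrec (.not ?_)) (.or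
          (.of_primrec (.not ?_)) ?_)))
      · exact PrimrecPair.mem (by fun_prop) (.dec (by fun_prop)) (by fun_prop)
      · exact sigma1_overlap (by fun_prop) (.dec (by fun_prop)) (.dec (by fun_prop))
      · exact PrimrecPair.mem (by fun_prop) (.dec (by fun_prop)) (by fun_prop)
      · exact PrimrecFin.eq (by fun_prop) (PrimrecPair.dec (by fun_prop)).2
          (PrimrecPair.dec (by fun_prop)).2
      · exact sigma1_separated (by fun_prop) (PrimrecPair.dec (by fun_prop)).2
          (.sub (by fun_prop) (PrimrecPair.dec (by fun_prop)).1
            (PrimrecPair.dec (by fun_prop)).1)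
  · refine Sigma1.forall_mem_map (fun x => decPair (d x)) hL ?_
    refine Sigma1.exists_mem_map (fun z : α × PairCode => List.map (decPair (d z.1)))
      (by fun_prop) (.of_primrec ?_)
    exact PrimrecPair.mem (by fun_prop) (.dec (by fun_prop)) (by fun_prop)

theorem sigma1_dividesCert (hd : Primrec d) (hA : PrimrecFin d A) {C D : α → List PairCode}
    (hC : Primrec C) (hD : Primrec D) :
    Sigma1 fun x => DividesCert (A x) ((C x).map (decPair (d x)))
      ((D x).map (decPair (d x))) := by
  refine Sigma1.exists_mem_map (fun x => decPair (d x)) hC ?_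
  refine Sigma1.exists_mem_map (fun z : α × PairCode => decPair (d z.1)) (by fun_prop)
    (.and (.of_primrec ?_) ?_)
  · exact PrimrecFin.subset (by fun_prop) (PrimrecPair.dec (by fun_prop)).2
      (PrimrecPair.dec (by fun_prop)).2
  · exact sigma1_inLocalization (by fun_prop) (hA.comp (by fun_prop))
      (PrimrecPair.dec (by fun_prop)).2 (.sub (by fun_prop) (PrimrecPair.dec (by fun_prop)).1
        (PrimrecPair.dec (by fun_prop)).1)

theorem sigma1_notDividesCert (hd : Primrec d) (hA : PrimrecFin d A) {C D : α → List PairCode}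
    (hC : Primrec C) (hD : Primrec D) :
    Sigma1 fun x => NotDividesCert (A x) ((C x).map (decPair (d x)))
      ((D x).map (decPair (d x))) := by
  refine Sigma1.forall_mem_map (fun x => decPair (d x)) hC ?_
  refine Sigma1.forall_mem_map (fun z : α × PairCode => decPair (d z.1)) (by fun_prop)
    (.or (.of_primrec (.not ?_)) ?_)
  · exact PrimrecFin.subset (by fun_prop) (PrimrecPair.dec (by fun_prop)).2
      (PrimrecPair.dec (by fun_prop)).2
  · exact sigma1_avoids (by fun_prop) (hA.comp (by fun_prop))
      (PrimrecPair.dec (by fun_prop)).2 (.sub (by fun_prop) (PrimrecPair.dec (by fun_prop)).1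
        (PrimrecPair.dec (by fun_prop)).1)

theorem sigma1_listsMaximal (hd : Primrec d) (hA : PrimrecFin d A)
    {M N : α → List (List PairCode)} (hM : Primrec M) (hN : Primrec N) :
    Sigma1 fun x => ListsMaximal (A x) ((M x).map (List.map (decPair (d x))))
      ((N x).map (List.map (decPair (d x)))) := by
  refine .and ?_ (.and (sigma1_pairwise_not_sameElems hd hN) (.and ?_ ?_))
  · refine Sigma1.forall_mem_map (fun x => List.map (decPair (d x))) hN ?_
    exact sigma1_nodup (by fun_prop) (by fun_prop)
  · refine Sigma1.forall_mem_map (fun x => List.map (decPair (d x))) hN ?_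
    refine Sigma1.exists_mem_map (fun z : α × List PairCode => List.map (decPair (d z.1)))
      (by fun_prop) (.and (.of_primrec ?_) ?_)
    · exact primrecPred_sameElems (by fun_prop) (by fun_prop) (by fun_prop)
    · refine Sigma1.forall_mem_map
        (fun z : (α × List PairCode) × List PairCode => List.map (decPair (d z.1.1)))
        (by fun_prop) (.or (.of_primrec ?_) ?_)
      · exact primrecPred_sameElems (by fun_prop) (by fun_prop) (by fun_prop)
      · exact sigma1_notDividesCert (by fun_prop) (hA.comp (by fun_prop)) (by fun_prop)
          (by fun_prop)
  · refine Sigma1.forall_mem_map (fun x => List.map (decPair (d x))) hM (.or ?_ ?_)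
    · refine Sigma1.exists_mem_map (fun z : α × List PairCode => List.map (decPair (d z.1)))
        (by fun_prop) (.of_primrec ?_)
      exact primrecPred_sameElems (by fun_prop) (by fun_prop) (by fun_prop)
    · refine Sigma1.exists_mem_map (fun z : α × List PairCode => List.map (decPair (d z.1)))
        (by fun_prop) (.and (.of_primrec (.not ?_)) ?_)
      · exact primrecPred_sameElems (by fun_prop) (by fun_prop) (by fun_prop)
      · exact sigma1_dividesCert (by fun_prop) (hA.comp (by fun_prop)) (by fun_prop)
          (by fun_prop)

/-- The code `c` is well-formed: the vectors have length `d`, and the list of the elements of the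
face has no repetitions. -/
def WellFormed (d : ℕ) (c : PairCode) : Prop :=
  c.1.length = d ∧ (∀ v ∈ c.2, v.length = d) ∧ c.2.Nodup

theorem sigma1_forall_wellFormed (hd : Primrec d) {L : α → List PairCode} (hL : Primrec L) :
    Sigma1 fun x => ∀ c ∈ L x, WellFormed (d x) c := by
  refine Sigma1.forall_mem hL (.and (.of_primrec ?_) (.and ?_ ?_))
  · exact Primrec.eq.comp (Primrec.list_length.comp (by fun_prop)) (by fun_prop)
  · exact Sigma1.forall_mem (by fun_prop) (.of_primrec
      (Primrec.eq.comp (Primrec.list_length.comp (by fun_prop)) (by fun_prop)))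
  · exact Sigma1.pairwise (by fun_prop)
      (.of_primrec (.not (Primrec.eq.comp (by fun_prop) (by fun_prop))))

theorem sigma1_forall_forall_wellFormed (hd : Primrec d) {M : α → List (List PairCode)}
    (hM : Primrec M) : Sigma1 fun x => ∀ C ∈ M x, ∀ c ∈ C, WellFormed (d x) c :=
  Sigma1.forall_mem hM (sigma1_forall_wellFormed (by fun_prop) (by fun_prop))

end

/-- `out` codes an output for the input `inp`. -/
def IsOutputCode (inp : Input) (out : Output) : Prop :=
  IsOutput (decFinset inp.1 inp.2.1) (decFinset inp.1 inp.2.2)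
    (out.1.map (decPair inp.1)) (out.2.1.map (List.map (decPair inp.1)))
    (out.2.2.map (List.map (decPair inp.1))) ∧
  (∀ c ∈ out.1, WellFormed inp.1 c) ∧ (∀ C ∈ out.2.1, ∀ c ∈ C, WellFormed inp.1 c) ∧
    ∀ C ∈ out.2.2, ∀ c ∈ C, WellFormed inp.1 c

theorem sigma1_isOutputCode : Sigma1 fun z : Input × Output => IsOutputCode z.1 z.2 := by
  have hd : Primrec fun z : Input × Output => z.1.1 := by fun_prop
  have hA : PrimrecFin (fun z : Input × Output => z.1.1) fun z => decFinset z.1.1 z.1.2.1 :=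
    .dec (by fun_prop)
  have hB : PrimrecFin (fun z : Input × Output => z.1.1) fun z => decFinset z.1.1 z.1.2.2 :=
    .dec (by fun_prop)
  exact .and
    (.and (sigma1_listsStandard hd hA hB (by fun_prop)) (.and (sigma1_nodup hd (by fun_prop))
      (.and (sigma1_listsClasses hd (by fun_prop) (by fun_prop))
        (sigma1_listsMaximal hd hA (by fun_prop) (by fun_prop)))))
    (.and (sigma1_forall_wellFormed hd (by fun_prop))
      (.and (sigma1_forall_forall_wellFormed hd (by fun_prop))
        (sigma1_forall_forall_wellFormed hd (by fun_prop))))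

/-! ### From decoded objects back to well-formed codes -/

section

variable {d : ℕ}

/-- Decoding pads and truncates, so it is injective only on codes of the right length; this is the
purpose of `WellFormed`. -/
theorem vecCode_decVec {c : VecCode} (hc : c.length = d) : vecCode (decVec d c) = c := by
  subst hc
  refine List.ext_getElem (by simp [vecCode]) fun i h₁ h₂ => ?_
  simp [vecCode, decVec, h₂]

/-- A well-formed code of a pair. -/
noncomputable def encPair (p : PairData d) : PairCode := (vecCode p.1, p.2.toList.map vecCode)

theorem decFinset_map_vecCode (l : List (Fin d → ℤ)) :
    decFinset d (l.map vecCode) = l.toFinset := by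
  have : decVec d ∘ vecCode = id := funext decVec_vecCode
  rw [decFinset, List.map_map, this, List.map_id]

theorem decPair_encPair (p : PairData d) : decPair d (encPair p) = p :=
  Prod.ext (decVec_vecCode p.1) ((decFinset_map_vecCode _).trans (Finset.toList_toFinset _))

theorem map_decPair_map_encPair (L : List (PairData d)) :
    (L.map encPair).map (decPair d) = L := by
  have : decPair d ∘ encPair = id := funext decPair_encPair
  rw [List.map_map, this, List.map_id]

theorem wellFormed_encPair (p : PairData d) : WellFormed d (encPair p) := by
  refine ⟨by simp [encPair, vecCode], fun v hv => ?_, ?_⟩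
  · obtain ⟨w, -, rfl⟩ := List.mem_map.1 hv
    simp [vecCode]
  · exact (Finset.nodup_toList _).map (Function.LeftInverse.injective decVec_vecCode)

theorem WellFormed.codesPair {c : PairCode} (h : WellFormed d c) :
    CodesPair c (decPair d c) := by
  obtain ⟨h₁, h₂, h₃⟩ := h
  refine ⟨(vecCode_decVec h₁).symm, c.2.map (decVec d), ?_, fun s => ?_, ?_⟩
  · refine h₃.map_on fun x hx y hy hxy => ?_
    rw [← vecCode_decVec (h₂ x hx), hxy, vecCode_decVec (h₂ y hy)]
  · exact mem_decFinset.symm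
  · rw [List.forall₂_map_right_iff, List.forall₂_same]
    exact fun v hv => (vecCode_decVec (h₂ v hv)).symm

theorem codesPairSet_of_wellFormed {L : List PairCode} (h : ∀ c ∈ L, WellFormed d c)
    (hL : (L.map (decPair d)).Nodup) {S : Set (PairData d)}
    (hS : ∀ p, p ∈ L.map (decPair d) ↔ p ∈ S) : CodesPairSet L S := by
  refine ⟨L.map (decPair d), hL, hS, ?_⟩
  rw [List.forall₂_map_right_iff, List.forall₂_same]
  exact fun c hc => (h c hc).codesPair

theorem Enumerates.codesPairSets {M : List (List PairCode)} {𝒮 : Set (Set (PairData d))}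
    (h : Enumerates (M.map (List.map (decPair d))) 𝒮) (hM : ∀ C ∈ M, ∀ c ∈ C, WellFormed d c) :
    CodesPairSets M 𝒮 := by
  refine ⟨(M.map (List.map (decPair d))).map fun C => {q | q ∈ C}, ?_, fun s => ?_, ?_⟩
  · rw [List.Nodup, List.pairwise_map]
    exact h.pairwise.imp fun hCD h => hCD (sameElems_iff.2 h)
  · rw [List.mem_map]
    exact ⟨fun ⟨C, hC, hs⟩ => hs ▸ h.mem C hC, h.exists_mem s⟩
  · rw [List.map_map, List.forall₂_map_right_iff, List.forall₂_same]
    exact fun C hC => codesPairSet_of_wellFormed (hM C hC)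
      (h.nodup _ (List.mem_map_of_mem hC)) fun p => Iff.rfl

/-- The field enters only here: the searched relation is about `IsStandard`, which is the same
condition for every `k`. -/
theorem IsOutputCode.codes {a b : List (Fin d → ℤ)} (ha : IsConfiguration a.toFinset)
    (hb : ∀ x ∈ b, x ∈ NN a.toFinset) {out : Output}
    (h : IsOutputCode (d, a.map vecCode, b.map vecCode) out) (k : Type*) [Field k] :
    CodesPairSet out.1 (stdPairs (monomialIdeal k a.toFinset b.toFinset)) ∧
      CodesPairSets out.2.1 (overlapClasses (monomialIdeal k a.toFinset b.toFinset)) ∧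
      CodesPairSets out.2.2 (maximalOverlapClasses (monomialIdeal k a.toFinset b.toFinset)) := by
  obtain ⟨h, hw₁, hw₂, hw₃⟩ := h
  simp only [decFinset_map_vecCode] at h
  obtain ⟨hL, hnodup, hM, hN⟩ := (isOutput_iff ha).1 h
  have hstd : stdPairs (monomialIdeal k a.toFinset b.toFinset) =
      {p | IsStandard a.toFinset b.toFinset p} :=
    Set.ext fun p => mem_stdPairs_iff ha fun x hx => hb x (List.mem_toFinset.1 hx)
  rw [← hstd] at hM hN
  refine ⟨codesPairSet_of_wellFormed hw₁ hnodup fun p => ?_, hM.codesPairSets hw₂,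
    hN.codesPairSets hw₃⟩
  rw [hstd]
  exact hL p

theorem exists_isOutputCode {a : List (Fin d → ℤ)} (ha : IsConfiguration a.toFinset)
    (b : List (Fin d → ℤ)) : ∃ out, IsOutputCode (d, a.map vecCode, b.map vecCode) out := by
  obtain ⟨L, M, N, h⟩ := exists_isOutput ha b.toFinset
  have hmap : ∀ M : List (List (PairData d)),
      (M.map (List.map encPair)).map (List.map (decPair d)) = M := fun M => by
    rw [List.map_map]
    exact (List.map_congr_left fun C _ => map_decPair_map_encPair C).trans (List.map_id M)
  have hwf : ∀ L : List (PairData d), ∀ c ∈ L.map encPair, WellFormed d c := fun L c hc => by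
    obtain ⟨p, -, rfl⟩ := List.mem_map.1 hc
    exact wellFormed_encPair p
  have hwf' : ∀ M : List (List (PairData d)), ∀ C ∈ M.map (List.map encPair), ∀ c ∈ C,
      WellFormed d c := fun M C hC => by
    obtain ⟨L, -, rfl⟩ := List.mem_map.1 hC
    exact hwf L
  refine ⟨(L.map encPair, M.map (List.map encPair), N.map (List.map encPair)), ?_, hwf L,
    hwf' M, hwf' N⟩
  simp only [decFinset_map_vecCode, map_decPair_map_encPair, hmap]
  exact h

end

end AffineSemigroup

theorem mainTheorem8 :
    ∃ f : Input →. Output, Partrec f ∧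
      ∀ (d : ℕ) (a b : List (Fin d → ℤ)),
        IsConfiguration a.toFinset →
        (∀ x ∈ b, x ∈ NN a.toFinset) →
        ∃ out : Output, out ∈ f (d, a.map vecCode, b.map vecCode) ∧
          ∀ (k : Type*) [Field k],
            CodesPairSet out.1 (stdPairs (monomialIdeal k a.toFinset b.toFinset)) ∧
            CodesPairSets out.2.1 (overlapClasses (monomialIdeal k a.toFinset b.toFinset)) ∧
            CodesPairSets out.2.2
              (maximalOverlapClasses (monomialIdeal k a.toFinset b.toFinset)) := by
  obtain ⟨f, hf, h⟩ := Sigma1.exists_partrec sigma1_isOutputCode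
  refine ⟨f, hf, fun d a b ha hb => ?_⟩
  obtain ⟨out, hout, hcode⟩ := h _ (exists_isOutputCode ha b)
  exact ⟨out, hout, fun k _ => hcode.codes ha hb k⟩
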